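/- **Conventions.** All operads are symmetric unital partial operads in real vector spaces: representations $\mathcal P(n)$ of $\mathbb S_n$ for $n\ge 0$, bilinear partial compositions $\circ_i:\mathcal P(n)\times\mathcal P(m)\to\mathcal P(n+m-1)$, $1\le i\le n$, and a unit in $\mathcal P(1)$, satisfying the sequential, parallel, equivariance and unit axioms. **The operad $\mathbb G$ of cooperative games.** $\mathbb G(n)$ is the space of functions $v:2^{[n]}\to\mathbb R$ with $v(\emptyset)=0$, on which $\mathbb S_n$ acts by $(\sigma\star v)(S)=v(\sigma^{-1}(S))$. For $\alpha\in\mathbb G(n)$, $\beta\in\mathbb G(m)$ and $i\in[n]$, the game $\alpha\circ_i\beta$ has as players those of $A=[n]$ with $i$ replaced by the players of $B=[m]$, and $$(\alpha\circ_i\beta)(S)=\beta(B)\,\alpha(S\cap A)+\bigl(\alpha((S\cap A)\cup\{i\})-\alpha((S\cap A)\setminus\{i\})\bigr)\,\beta(S\cap B).$$ The unit is the one-player game with $v(\{1\})=1$. Let $d_1,B\in\mathbb G(2)$ be the dictator game ($d_1(S)=1$ if $1\in S$, and $0$ otherwise) and the bargaining game ($B(\{1,2\})=1$, and $B(S)=0$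 otherwise). For $\emptyset\ne S\subseteq[n]$ let $u_S\in\mathbb G(n)$ be the unanimity game, $u_S(T)=1$ if $S\subseteq T$ and $0$ otherwise. The Möbius transform of $v$ is $\mu^v(S)=\sum_{T\subseteq S}(-1)^{|S\setminus T|}v(T)$. **The operad $\mathcal{C}om\mathcal{T}riass$ of commutative trialgebras.** It is $\mathbb T(M)/(R)$, the quotient of the free operad on $M=(0,0,\mathbb R[\mathbb S_2]\cdot\nu\oplus\mathbb R\cdot\mu,0,\dots)$, where $\nu$ has no symmetry and $\mu$ is symmetric, by the operadic ideal generated by the relations $$\mu\circ_1\mu=\mu\circ_2\mu,\qquad \nu\circ_1\nu=\nu\circ_2\nu=\nu\circ_2((21)\star\nu),\qquad \nu\circ_2\mu=\nu\circ_2\nu,\qquad \nu\circ_1\mu=\mu\circ_2\nu.$$ For $S=\{s_1<\dots<s_k\}\subseteq[n]$ non-empty with complement $\{t_1<\dots<t_l\}$, let $e_S\in\mathcal{C}om\mathcal{T}riass(n)$ be the operation $$e_S(x_1,\dots,x_n)=\nu(\cdots\nu(\nu(\mu(\cdots\mu(x_{s_1},x_{s_2})\cdots,x_{s_k}),x_{t_1}),x_{t_2})\cdots,x_{t_l}).$$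 **Theorem.** There is an isomorphism of operads $\varphi:\mathcal{C}om\mathcal{T}riass\to\mathbb G$ with $\varphi(\nu)=d_1$ and $\varphi(\mu)=B$, and it is the only morphism of operads $\mathcal{C}om\mathcal{T}riass\to\mathbb G$ with these two values. Moreover, for every $n\ge 0$: 1. the operations $e_S$, $\emptyset\neq S\subseteq[n]$, form a basis of $\mathcal{C}om\mathcal{T}riass(n)$, and $\varphi(e_S)=u_S$; 2. in this basis the inverse of $\varphi$ is the Möbius transform: $\varphi^{-1}(v)=\sum_{\emptyset\ne S\subseteq[n]}\mu^v(S)\,e_S$ for all $v\in\mathbb G(n)$; 3. $\dim\mathcal{C}om\mathcal{T}riass(n)=2^n-1$. -/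

import Mathlib

open Equiv

universe u v

noncomputable section

/-! ### Insertion of a block of positions -/

/-- Substituting `m` new positions for the position `i` among `n` positions gives `k = n + m - 1`
positions.  The bijection sends an old position `a < i` to `a`, an old position `a > i` to
`a + m - 1`, and the new position `b` to `i + b` (all positions are counted from `0`). -/
def insertEquiv {n m k : ℕ} (h : n + m = k + 1) (i : Fin n) :
    {a : Fin n // a ≠ i} ⊕ Fin m ≃ Fin k where
  toFun := Sum.elim
    (fun a => ⟨if a.1.val < i.val then a.1.val else a.1.val + m - 1, by
      have h1 := a.1.isLt
      have h2 := i.isLt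
      have h3 : a.1.val ≠ i.val := fun e => a.2 (Fin.ext e)
      split <;> omega⟩)
    (fun b => ⟨i.val + b.val, by
      have h1 := i.isLt
      have h2 := b.isLt
      omega⟩)
  invFun x :=
    if h1 : x.val < i.val then
      Sum.inl ⟨⟨x.val, by have := i.isLt; omega⟩, fun e => by
        have := congrArg Fin.val e; simp at this; omega⟩
    else if h2 : x.val < i.val + m then Sum.inr ⟨x.val - i.val, by omega⟩
    else Sum.inl ⟨⟨x.val + 1 - m, by have := x.isLt; omega⟩, fun e => by
        have := congrArg Fin.val e; simp at this; omega⟩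
  left_inv x := by
    rcases x with ⟨a, ha⟩ | b
    · have h3 : a.val ≠ i.val := fun e => ha (Fin.ext e)
      by_cases h1 : a.val < i.val
      · simp only [Sum.elim_inl, h1, if_true, dite_true]
      · have h4 : ¬ (a.val + m - 1 < i.val) := by omega
        have h5 : ¬ (a.val + m - 1 < i.val + m) := by omega
        simp only [Sum.elim_inl, h1, if_false, h4, dite_false, h5]
        congr 2
        apply Fin.ext
        simp only
        omega
    · have h1 : ¬ (i.val + b.val < i.val) := by omega
      have h2 : i.val + b.val < i.val + m := by have := b.isLt; omega
      simp [h2]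
  right_inv x := by
    apply Fin.ext
    by_cases h1 : x.val < i.val
    · simp only [h1, dite_true, Sum.elim_inl, if_true]
    · by_cases h2 : x.val < i.val + m
      · simp only [h1, dite_false, h2, dite_true, Sum.elim_inr]
        omega
      · have h3 : ¬ (x.val + 1 - m < i.val) := by omega
        simp only [h1, dite_false, h2, Sum.elim_inl, h3, if_false]
        omega

/-- The permutation of `Fin k` acting as `σ` on the block substituted for the position `i`, and as
the identity elsewhere. -/
def innerPerm {n m k : ℕ} (h : n + m = k + 1) (i : Fin n) (σ : Perm (Fin m)) : Perm (Fin k) :=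
  (insertEquiv h i).symm.trans
    ((Equiv.sumCongr (Equiv.refl {a : Fin n // a ≠ i}) σ).trans (insertEquiv h i))

/-- The permutation of `Fin k` acting as `τ` on the positions outside of the block substituted for
`i`, and moving this block, in an order preserving way, to the block substituted for `τ i`. -/
def outerPerm {n m k : ℕ} (h : n + m = k + 1) (i : Fin n) (τ : Perm (Fin n)) : Perm (Fin k) :=
  (insertEquiv h i).symm.trans
    ((Equiv.sumCongr
        (Equiv.subtypeEquiv τ (fun _ => (τ.injective.ne_iff).symm) :
          {a : Fin n // a ≠ i} ≃ {a : Fin n // a ≠ τ i})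
        (Equiv.refl (Fin m))).trans (insertEquiv h (τ i)))

/-! ### Modules over the symmetric groups and linear operads -/

/-- An `𝕊`-module over `ℝ`: a representation of the symmetric group `𝕊ₙ` for every `n ≥ 0`. -/
structure SModule where
  carrier : ℕ → Type u
  [addCommGroup : ∀ n, AddCommGroup (carrier n)]
  [module : ∀ n, Module ℝ (carrier n)]
  act : ∀ n, Perm (Fin n) →* (carrier n →ₗ[ℝ] carrier n)

attribute [instance] SModule.addCommGroup SModule.module

/-- A morphism of `𝕊`-modules: a family of equivariant linear maps. -/
structure SModule.Hom (M : SModule.{u}) (N : SModule.{v}) where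
  toFun : ∀ n, M.carrier n →ₗ[ℝ] N.carrier n
  map_act : ∀ {n : ℕ} (σ : Perm (Fin n)) (x : M.carrier n),
    toFun n (M.act n σ x) = N.act n σ (toFun n x)

/-- A unital partial (linear, symmetric) operad.  The partial composition `a ∘ᵢ b` of an operation
`a` of arity `n` and an operation `b` of arity `m` has arity `n + m - 1`; to avoid transports along
equalities of natural numbers this arity is written `k`, with a proof of `n + m = k + 1`.
Inputs are counted from `0`, so that the indices `i + j - 1` and `k + q - 1` of the sequential and
parallel axioms, counted from `1`, become `i + j` and `k + q - 1`. -/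
structure LinearOperad extends SModule.{u} where
  one : carrier 1
  comp : ∀ {n m k : ℕ} (_ : n + m = k + 1) (_ : Fin n),
    carrier n →ₗ[ℝ] carrier m →ₗ[ℝ] carrier k
  sequential : ∀ {p q r s t w : ℕ} (h₁ : p + q = s + 1) (h₂ : s + r = w + 1) (h₃ : q + r = t + 1)
    (h₄ : p + t = w + 1) (i : Fin p) (j : Fin q) (l : Fin s), l.val = i.val + j.val →
    ∀ (a : carrier p) (b : carrier q) (c : carrier r),
      comp h₂ l (comp h₁ i a b) c = comp h₄ i a (comp h₃ j b c)
  parallel : ∀ {p q r s t w : ℕ} (h₁ : p + q = s + 1) (h₂ : s + r = w + 1) (h₃ : p + r = t + 1)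
    (h₄ : t + q = w + 1) (i j : Fin p) (l : Fin s) (i' : Fin t), i < j →
    l.val + 1 = j.val + q → i'.val = i.val →
    ∀ (a : carrier p) (b : carrier q) (c : carrier r),
      comp h₂ l (comp h₁ i a b) c = comp h₄ i' (comp h₃ j a c) b
  comp_act : ∀ {n m k : ℕ} (h : n + m = k + 1) (i : Fin n) (σ : Perm (Fin m))
    (a : carrier n) (b : carrier m),
      comp h i a (act m σ b) = act k (innerPerm h i σ) (comp h i a b)
  act_comp : ∀ {n m k : ℕ} (h : n + m = k + 1) (i : Fin n) (τ : Perm (Fin n))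
    (a : carrier n) (b : carrier m),
      comp h (τ i) (act n τ a) b = act k (outerPerm h i τ) (comp h i a b)
  comp_one : ∀ {n : ℕ} (i : Fin n) (a : carrier n), comp rfl i a one = a
  one_comp : ∀ {n : ℕ} (a : carrier n), comp (Nat.add_comm 1 n) 0 one a = a

/-- A morphism of operads. -/
structure LinearOperad.Hom (P : LinearOperad.{u}) (Q : LinearOperad.{v}) extends
    SModule.Hom P.toSModule Q.toSModule where
  map_one : toFun 1 P.one = Q.one
  map_comp : ∀ {n m k : ℕ} (h : n + m = k + 1) (i : Fin n) (a : P.carrier n) (b : P.carrier m),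
    toFun k (P.comp h i a b) = Q.comp h i (toFun n a) (toFun m b)

/-- An isomorphism of operads: a morphism with a two-sided inverse morphism. -/
structure LinearOperad.Iso (P : LinearOperad.{u}) (Q : LinearOperad.{v}) where
  hom : P.Hom Q
  inv : Q.Hom P
  inv_hom : ∀ (n : ℕ) (x : P.carrier n), inv.toFun n (hom.toFun n x) = x
  hom_inv : ∀ (n : ℕ) (y : Q.carrier n), hom.toFun n (inv.toFun n y) = y

/-! ### The free operad on an `𝕊`-module -/

namespace FreeOperad

/-- Formal expressions of arity `n` in the elements of the `𝕊`-module `M`, the operadic unit, the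
partial compositions, the actions of the symmetric groups and the linear structure. -/
inductive Pre (M : SModule.{u}) : ℕ → Type u
  | gen {n : ℕ} (x : M.carrier n) : Pre M n
  | one : Pre M 1
  | zero (n : ℕ) : Pre M n
  | add {n : ℕ} (a b : Pre M n) : Pre M n
  | smul {n : ℕ} (r : ℝ) (a : Pre M n) : Pre M n
  | act {n : ℕ} (σ : Perm (Fin n)) (a : Pre M n) : Pre M n
  | comp {n m k : ℕ} (h : n + m = k + 1) (i : Fin n) (a : Pre M n) (b : Pre M m) : Pre M k

open Pre in
/-- The equivalence relation on formal expressions generated by exactly the identities which hold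
in every operad that receives a morphism of `𝕊`-modules from `M`. -/
inductive Rel (M : SModule.{u}) : ∀ {n : ℕ}, Pre M n → Pre M n → Prop
  | refl {n : ℕ} (a : Pre M n) : Rel M a a
  | symm {n : ℕ} {a b : Pre M n} : Rel M a b → Rel M b a
  | trans {n : ℕ} {a b c : Pre M n} : Rel M a b → Rel M b c → Rel M a c
  | add_congr {n : ℕ} {a a' b b' : Pre M n} :
      Rel M a a' → Rel M b b' → Rel M (add a b) (add a' b')
  | smul_congr {n : ℕ} (r : ℝ) {a a' : Pre M n} : Rel M a a' → Rel M (smul r a) (smul r a')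
  | act_congr {n : ℕ} (σ : Perm (Fin n)) {a a' : Pre M n} :
      Rel M a a' → Rel M (act σ a) (act σ a')
  | comp_congr {n m k : ℕ} (h : n + m = k + 1) (i : Fin n) {a a' : Pre M n} {b b' : Pre M m} :
      Rel M a a' → Rel M b b' → Rel M (comp h i a b) (comp h i a' b')
  | add_assoc {n : ℕ} (a b c : Pre M n) : Rel M (add (add a b) c) (add a (add b c))
  | add_comm {n : ℕ} (a b : Pre M n) : Rel M (add a b) (add b a)
  | zero_add {n : ℕ} (a : Pre M n) : Rel M (add (zero n) a) a
  | zero_smul {n : ℕ} (a : Pre M n) : Rel M (smul 0 a) (zero n)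
  | one_smul {n : ℕ} (a : Pre M n) : Rel M (smul 1 a) a
  | mul_smul {n : ℕ} (r s : ℝ) (a : Pre M n) : Rel M (smul (r * s) a) (smul r (smul s a))
  | smul_add {n : ℕ} (r : ℝ) (a b : Pre M n) :
      Rel M (smul r (add a b)) (add (smul r a) (smul r b))
  | add_smul {n : ℕ} (r s : ℝ) (a : Pre M n) :
      Rel M (smul (r + s) a) (add (smul r a) (smul s a))
  | gen_add {n : ℕ} (x y : M.carrier n) : Rel M (gen (x + y)) (add (gen x) (gen y))
  | gen_smul {n : ℕ} (r : ℝ) (x : M.carrier n) : Rel M (gen (r • x)) (smul r (gen x))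
  | gen_act {n : ℕ} (σ : Perm (Fin n)) (x : M.carrier n) :
      Rel M (gen (M.act n σ x)) (act σ (gen x))
  | act_add {n : ℕ} (σ : Perm (Fin n)) (a b : Pre M n) :
      Rel M (act σ (add a b)) (add (act σ a) (act σ b))
  | act_smul {n : ℕ} (σ : Perm (Fin n)) (r : ℝ) (a : Pre M n) :
      Rel M (act σ (smul r a)) (smul r (act σ a))
  | act_one {n : ℕ} (a : Pre M n) : Rel M (act 1 a) a
  | act_mul {n : ℕ} (σ τ : Perm (Fin n)) (a : Pre M n) :
      Rel M (act (σ * τ) a) (act σ (act τ a))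
  | comp_add_left {n m k : ℕ} (h : n + m = k + 1) (i : Fin n) (a a' : Pre M n) (b : Pre M m) :
      Rel M (comp h i (add a a') b) (add (comp h i a b) (comp h i a' b))
  | comp_smul_left {n m k : ℕ} (h : n + m = k + 1) (i : Fin n) (r : ℝ) (a : Pre M n)
      (b : Pre M m) : Rel M (comp h i (smul r a) b) (smul r (comp h i a b))
  | comp_add_right {n m k : ℕ} (h : n + m = k + 1) (i : Fin n) (a : Pre M n) (b b' : Pre M m) :
      Rel M (comp h i a (add b b')) (add (comp h i a b) (comp h i a b'))
  | comp_smul_right {n m k : ℕ} (h : n + m = k + 1) (i : Fin n) (r : ℝ) (a : Pre M n)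
      (b : Pre M m) : Rel M (comp h i a (smul r b)) (smul r (comp h i a b))
  | sequential {p q r s t w : ℕ} (h₁ : p + q = s + 1) (h₂ : s + r = w + 1) (h₃ : q + r = t + 1)
      (h₄ : p + t = w + 1) (i : Fin p) (j : Fin q) (l : Fin s) (hl : l.val = i.val + j.val)
      (a : Pre M p) (b : Pre M q) (c : Pre M r) :
      Rel M (comp h₂ l (comp h₁ i a b) c) (comp h₄ i a (comp h₃ j b c))
  | parallel {p q r s t w : ℕ} (h₁ : p + q = s + 1) (h₂ : s + r = w + 1) (h₃ : p + r = t + 1)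
      (h₄ : t + q = w + 1) (i j : Fin p) (l : Fin s) (i' : Fin t) (hij : i < j)
      (hl : l.val + 1 = j.val + q) (hi : i'.val = i.val)
      (a : Pre M p) (b : Pre M q) (c : Pre M r) :
      Rel M (comp h₂ l (comp h₁ i a b) c) (comp h₄ i' (comp h₃ j a c) b)
  | comp_act {n m k : ℕ} (h : n + m = k + 1) (i : Fin n) (σ : Perm (Fin m))
      (a : Pre M n) (b : Pre M m) :
      Rel M (comp h i a (act σ b)) (act (innerPerm h i σ) (comp h i a b))
  | act_comp {n m k : ℕ} (h : n + m = k + 1) (i : Fin n) (τ : Perm (Fin n))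
      (a : Pre M n) (b : Pre M m) :
      Rel M (comp h (τ i) (act τ a) b) (act (outerPerm h i τ) (comp h i a b))
  | comp_one {n : ℕ} (i : Fin n) (a : Pre M n) : Rel M (comp rfl i a one) a
  | one_comp {n : ℕ} (a : Pre M n) : Rel M (comp (Nat.add_comm 1 n) 0 one a) a

/-- The setoid of the relation `Rel`. -/
def relSetoid (M : SModule.{u}) (n : ℕ) : Setoid (Pre M n) :=
  ⟨Rel M, ⟨Rel.refl, Rel.symm, Rel.trans⟩⟩

/-- The space of operations of arity `n` of the free operad. -/
def Carrier (M : SModule.{u}) (n : ℕ) : Type u := Quotient (relSetoid M n)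

variable {M : SModule.{u}}

/-- The class of a formal expression. -/
def mk {n : ℕ} (a : Pre M n) : Carrier M n := Quotient.mk (relSetoid M n) a

theorem mk_eq {n : ℕ} {a b : Pre M n} (h : Rel M a b) : mk a = mk b :=
  Quotient.sound (s := relSetoid M n) h

theorem mk_surjective {n : ℕ} (x : Carrier M n) : ∃ a, mk a = x := Quotient.exists_rep x

instance (n : ℕ) : Add (Carrier M n) :=
  ⟨Quotient.map₂ Pre.add fun _ _ h _ _ h' => Rel.add_congr h h'⟩

instance (n : ℕ) : Zero (Carrier M n) := ⟨mk (Pre.zero n)⟩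

instance (n : ℕ) : SMul ℝ (Carrier M n) :=
  ⟨fun r => Quotient.map (Pre.smul r) fun _ _ h => Rel.smul_congr r h⟩

instance (n : ℕ) : Neg (Carrier M n) := ⟨fun x => (-1 : ℝ) • x⟩

theorem mk_add {n : ℕ} (a b : Pre M n) : mk (Pre.add a b) = mk a + mk b := rfl

theorem mk_smul {n : ℕ} (r : ℝ) (a : Pre M n) : mk (Pre.smul r a) = r • mk a := rfl

theorem mk_zero {n : ℕ} : mk (Pre.zero n : Pre M n) = 0 := rfl

protected theorem zero_smul' {n : ℕ} (x : Carrier M n) : (0 : ℝ) • x = 0 := by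
  obtain ⟨a, rfl⟩ := mk_surjective x
  exact mk_eq (Rel.zero_smul a)

protected theorem one_smul' {n : ℕ} (x : Carrier M n) : (1 : ℝ) • x = x := by
  obtain ⟨a, rfl⟩ := mk_surjective x
  exact mk_eq (Rel.one_smul a)

protected theorem add_smul' {n : ℕ} (r s : ℝ) (x : Carrier M n) :
    (r + s) • x = r • x + s • x := by
  obtain ⟨a, rfl⟩ := mk_surjective x
  exact mk_eq (Rel.add_smul r s a)

protected theorem mul_smul' {n : ℕ} (r s : ℝ) (x : Carrier M n) :
    (r * s) • x = r • s • x := by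
  obtain ⟨a, rfl⟩ := mk_surjective x
  exact mk_eq (Rel.mul_smul r s a)

protected theorem smul_add' {n : ℕ} (r : ℝ) (x y : Carrier M n) :
    r • (x + y) = r • x + r • y := by
  obtain ⟨a, rfl⟩ := mk_surjective x
  obtain ⟨b, rfl⟩ := mk_surjective y
  exact mk_eq (Rel.smul_add r a b)

protected theorem add_comm' {n : ℕ} (x y : Carrier M n) : x + y = y + x := by
  obtain ⟨a, rfl⟩ := mk_surjective x
  obtain ⟨b, rfl⟩ := mk_surjective y
  exact mk_eq (Rel.add_comm a b)

protected theorem zero_add' {n : ℕ} (x : Carrier M n) : 0 + x = x := by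
  obtain ⟨a, rfl⟩ := mk_surjective x
  exact mk_eq (Rel.zero_add a)

instance (n : ℕ) : AddCommGroup (Carrier M n) where
  add_assoc x y z := by
    obtain ⟨a, rfl⟩ := mk_surjective x
    obtain ⟨b, rfl⟩ := mk_surjective y
    obtain ⟨c, rfl⟩ := mk_surjective z
    exact mk_eq (Rel.add_assoc a b c)
  zero_add := FreeOperad.zero_add'
  add_zero x := by rw [FreeOperad.add_comm', FreeOperad.zero_add']
  add_comm := FreeOperad.add_comm'
  nsmul := nsmulRec
  zsmul := zsmulRec
  neg_add_cancel x := by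
    change (-1 : ℝ) • x + x = 0
    conv_lhs => rw [← FreeOperad.one_smul' x]
    rw [← FreeOperad.mul_smul', ← FreeOperad.add_smul']
    norm_num [FreeOperad.zero_smul']

instance (n : ℕ) : Module ℝ (Carrier M n) where
  one_smul := FreeOperad.one_smul'
  mul_smul := FreeOperad.mul_smul'
  smul_zero r := by
    rw [← FreeOperad.zero_smul' (0 : Carrier M n), ← FreeOperad.mul_smul', mul_zero]
  smul_add := FreeOperad.smul_add'
  add_smul := FreeOperad.add_smul'
  zero_smul := FreeOperad.zero_smul'

/-- The action of the symmetric groups on the free operad. -/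
def actHom (M : SModule.{u}) (n : ℕ) : Perm (Fin n) →* (Carrier M n →ₗ[ℝ] Carrier M n) where
  toFun σ :=
    { toFun := Quotient.map (Pre.act σ) fun _ _ h => Rel.act_congr σ h
      map_add' := fun x y => by
        obtain ⟨a, rfl⟩ := mk_surjective x
        obtain ⟨b, rfl⟩ := mk_surjective y
        exact mk_eq (Rel.act_add σ a b)
      map_smul' := fun r x => by
        obtain ⟨a, rfl⟩ := mk_surjective x
        exact mk_eq (Rel.act_smul σ r a) }
  map_one' := by
    ext x
    obtain ⟨a, rfl⟩ := mk_surjective x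
    exact mk_eq (Rel.act_one a)
  map_mul' σ τ := by
    ext x
    obtain ⟨a, rfl⟩ := mk_surjective x
    exact mk_eq (Rel.act_mul σ τ a)

/-- The partial compositions of the free operad. -/
def compHom (M : SModule.{u}) {n m k : ℕ} (h : n + m = k + 1) (i : Fin n) :
    Carrier M n →ₗ[ℝ] Carrier M m →ₗ[ℝ] Carrier M k :=
  LinearMap.mk₂ ℝ
    (Quotient.map₂ (Pre.comp h i) fun _ _ h₁ _ _ h₂ => Rel.comp_congr h i h₁ h₂)
    (fun x y z => by
      obtain ⟨a, rfl⟩ := mk_surjective x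
      obtain ⟨b, rfl⟩ := mk_surjective y
      obtain ⟨c, rfl⟩ := mk_surjective z
      exact mk_eq (Rel.comp_add_left h i a b c))
    (fun r x y => by
      obtain ⟨a, rfl⟩ := mk_surjective x
      obtain ⟨b, rfl⟩ := mk_surjective y
      exact mk_eq (Rel.comp_smul_left h i r a b))
    (fun x y z => by
      obtain ⟨a, rfl⟩ := mk_surjective x
      obtain ⟨b, rfl⟩ := mk_surjective y
      obtain ⟨c, rfl⟩ := mk_surjective z
      exact mk_eq (Rel.comp_add_right h i a b c))
    (fun r x y => by
      obtain ⟨a, rfl⟩ := mk_surjective x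
      obtain ⟨b, rfl⟩ := mk_surjective y
      exact mk_eq (Rel.comp_smul_right h i r a b))

end FreeOperad

/-- The free operad `𝕋(M)` on an `𝕊`-module `M`. -/
def FreeOperad (M : SModule.{u}) : LinearOperad.{u} where
  carrier := FreeOperad.Carrier M
  act := FreeOperad.actHom M
  one := FreeOperad.mk FreeOperad.Pre.one
  comp := FreeOperad.compHom M
  sequential h₁ h₂ h₃ h₄ i j l hl x y z := by
    obtain ⟨a, rfl⟩ := FreeOperad.mk_surjective x
    obtain ⟨b, rfl⟩ := FreeOperad.mk_surjective y
    obtain ⟨c, rfl⟩ := FreeOperad.mk_surjective z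
    exact FreeOperad.mk_eq (FreeOperad.Rel.sequential h₁ h₂ h₃ h₄ i j l hl a b c)
  parallel h₁ h₂ h₃ h₄ i j l i' hij hl hi x y z := by
    obtain ⟨a, rfl⟩ := FreeOperad.mk_surjective x
    obtain ⟨b, rfl⟩ := FreeOperad.mk_surjective y
    obtain ⟨c, rfl⟩ := FreeOperad.mk_surjective z
    exact FreeOperad.mk_eq (FreeOperad.Rel.parallel h₁ h₂ h₃ h₄ i j l i' hij hl hi a b c)
  comp_act h i σ x y := by
    obtain ⟨a, rfl⟩ := FreeOperad.mk_surjective x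
    obtain ⟨b, rfl⟩ := FreeOperad.mk_surjective y
    exact FreeOperad.mk_eq (FreeOperad.Rel.comp_act h i σ a b)
  act_comp h i τ x y := by
    obtain ⟨a, rfl⟩ := FreeOperad.mk_surjective x
    obtain ⟨b, rfl⟩ := FreeOperad.mk_surjective y
    exact FreeOperad.mk_eq (FreeOperad.Rel.act_comp h i τ a b)
  comp_one i x := by
    obtain ⟨a, rfl⟩ := FreeOperad.mk_surjective x
    exact FreeOperad.mk_eq (FreeOperad.Rel.comp_one i a)
  one_comp x := by
    obtain ⟨a, rfl⟩ := FreeOperad.mk_surjective x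
    exact FreeOperad.mk_eq (FreeOperad.Rel.one_comp a)

namespace FreeOperad

/-- The inclusion of the generators into the free operad. -/
def ι (M : SModule.{u}) : SModule.Hom M (FreeOperad M).toSModule where
  toFun n :=
    { toFun := fun x => mk (Pre.gen x)
      map_add' := fun x y => mk_eq (Rel.gen_add x y)
      map_smul' := fun r x => mk_eq (Rel.gen_smul r x) }
  map_act σ x := mk_eq (Rel.gen_act σ x)

variable {M : SModule.{u}}

/-- The value of a formal expression in an operad. -/
def eval (Q : LinearOperad.{v}) (f : SModule.Hom M Q.toSModule) :
    ∀ {n : ℕ}, Pre M n → Q.carrier n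
  | _, Pre.gen x => f.toFun _ x
  | _, Pre.one => Q.one
  | _, Pre.zero _ => 0
  | _, Pre.add a b => eval Q f a + eval Q f b
  | _, Pre.smul r a => r • eval Q f a
  | _, Pre.act σ a => Q.act _ σ (eval Q f a)
  | _, Pre.comp h i a b => Q.comp h i (eval Q f a) (eval Q f b)

theorem eval_eq (Q : LinearOperad.{v}) (f : SModule.Hom M Q.toSModule) {n : ℕ} {a b : Pre M n}
    (h : Rel M a b) : eval Q f a = eval Q f b := by
  induction h with
  | refl => rfl
  | symm _ ih => exact ih.symm
  | trans _ _ ih₁ ih₂ => exact ih₁.trans ih₂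
  | add_congr _ _ ih₁ ih₂ => simp only [eval, ih₁, ih₂]
  | smul_congr _ _ ih => simp only [eval, ih]
  | act_congr _ _ ih => simp only [eval, ih]
  | comp_congr _ _ _ _ ih₁ ih₂ => simp only [eval, ih₁, ih₂]
  | add_assoc => simp only [eval, add_assoc]
  | add_comm => simp only [eval]; exact add_comm _ _
  | zero_add => simp only [eval, zero_add]
  | zero_smul => simp only [eval, zero_smul]
  | one_smul => simp only [eval, one_smul]
  | mul_smul => simp only [eval, mul_smul]
  | smul_add => simp only [eval, smul_add]
  | add_smul => simp only [eval, add_smul]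
  | gen_add => simp only [eval, map_add]
  | gen_smul => simp only [eval, map_smul]
  | gen_act => simp only [eval, f.map_act]
  | act_add => simp only [eval, map_add]
  | act_smul => simp only [eval, map_smul]
  | act_one => simp only [eval, map_one, Module.End.one_apply]
  | act_mul => simp only [eval, map_mul, Module.End.mul_apply]
  | comp_add_left => simp only [eval, map_add, LinearMap.add_apply]
  | comp_smul_left => simp only [eval, map_smul, LinearMap.smul_apply]
  | comp_add_right => simp only [eval, map_add]
  | comp_smul_right => simp only [eval, map_smul]
  | sequential h₁ h₂ h₃ h₄ i j l hl a b c => exact Q.sequential h₁ h₂ h₃ h₄ i j l hl _ _ _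
  | parallel h₁ h₂ h₃ h₄ i j l i' hij hl hi a b c =>
    exact Q.parallel h₁ h₂ h₃ h₄ i j l i' hij hl hi _ _ _
  | comp_act h i σ a b => exact Q.comp_act h i σ _ _
  | act_comp h i τ a b => exact Q.act_comp h i τ _ _
  | comp_one i a => exact Q.comp_one i _
  | one_comp a => exact Q.one_comp _

/-- The universal property of the free operad, which characterizes it: a morphism of `𝕊`-modules
from `M` to (the `𝕊`-module underlying) an operad extends uniquely to a morphism of operads. -/
theorem existsUnique_lift (Q : LinearOperad.{v}) (f : SModule.Hom M Q.toSModule) :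
    ∃! F : LinearOperad.Hom (FreeOperad M) Q,
      ∀ (n : ℕ) (x : M.carrier n), F.toFun n ((ι M).toFun n x) = f.toFun n x := by
  refine ⟨{ toFun := fun n =>
              { toFun := Quotient.lift (fun a : Pre M n => eval Q f a) fun _ _ h => eval_eq Q f h
                map_add' := ?_
                map_smul' := ?_ }
            map_act := ?_
            map_one := rfl
            map_comp := ?_ }, fun n x => rfl, ?_⟩
  · intro x y
    obtain ⟨a, rfl⟩ := mk_surjective x
    obtain ⟨b, rfl⟩ := mk_surjective y
    rfl
  · intro r x
    obtain ⟨a, rfl⟩ := mk_surjective x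
    rfl
  · intro _ σ x
    obtain ⟨a, rfl⟩ := mk_surjective x
    rfl
  · intro n m k h i x y
    obtain ⟨a, rfl⟩ := mk_surjective x
    obtain ⟨b, rfl⟩ := mk_surjective y
    rfl
  · intro F hF
    have key : ∀ {n : ℕ} (a : Pre M n), F.toFun n (mk a) = eval Q f a := by
      intro n a
      induction a with
      | gen x => exact hF _ x
      | one => exact F.map_one
      | zero n => exact map_zero (F.toFun n)
      | add a b iha ihb =>
        exact (map_add (F.toFun _) (mk a) (mk b)).trans (congrArg₂ (· + ·) iha ihb)
      | smul r a iha => exact (map_smul (F.toFun _) r (mk a)).trans (congrArg (r • ·) iha)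
      | act σ a iha => exact (F.map_act σ (mk a)).trans (by rw [iha]; rfl)
      | comp h i a b iha ihb =>
        exact (F.map_comp h i (mk a) (mk b)).trans (by rw [iha, ihb]; rfl)
    obtain ⟨⟨F, _⟩, _, _⟩ := F
    congr
    funext n
    ext x
    obtain ⟨a, rfl⟩ := mk_surjective x
    exact key a

end FreeOperad

/-! ### Operadic ideals and quotients -/

/-- An operadic ideal: a sub-`𝕊`-module which is stable under partial composition, on both sides,
with arbitrary operations. -/
structure OperadIdeal (P : LinearOperad.{u}) where
  carrier : ∀ n, Submodule ℝ (P.carrier n)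
  act_mem : ∀ {n : ℕ} (σ : Perm (Fin n)) {a : P.carrier n}, a ∈ carrier n →
    P.act n σ a ∈ carrier n
  comp_mem_left : ∀ {n m k : ℕ} (h : n + m = k + 1) (i : Fin n) {a : P.carrier n}
    (b : P.carrier m), a ∈ carrier n → P.comp h i a b ∈ carrier k
  comp_mem_right : ∀ {n m k : ℕ} (h : n + m = k + 1) (i : Fin n) (a : P.carrier n)
    {b : P.carrier m}, b ∈ carrier m → P.comp h i a b ∈ carrier k

/-- The operadic ideal `(R)` generated by a family `R` of sets of operations: the intersection of
all the ideals which contain `R`. -/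
def OperadIdeal.span (P : LinearOperad.{u}) (R : ∀ n, Set (P.carrier n)) : OperadIdeal P where
  carrier n := sInf {V | ∃ I : OperadIdeal P, (∀ m, R m ⊆ I.carrier m) ∧ V = I.carrier n}
  act_mem σ a ha := by
    rw [Submodule.mem_sInf] at ha ⊢
    rintro _ ⟨I, hI, rfl⟩
    exact I.act_mem σ (ha _ ⟨I, hI, rfl⟩)
  comp_mem_left h i a b ha := by
    rw [Submodule.mem_sInf] at ha ⊢
    rintro _ ⟨I, hI, rfl⟩
    exact I.comp_mem_left h i b (ha _ ⟨I, hI, rfl⟩)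
  comp_mem_right h i a b hb := by
    rw [Submodule.mem_sInf] at hb ⊢
    rintro _ ⟨I, hI, rfl⟩
    exact I.comp_mem_right h i a (hb _ ⟨I, hI, rfl⟩)

namespace OperadIdeal

variable {P : LinearOperad.{u}} (I : OperadIdeal P)

/-- The action of the symmetric groups on the quotient of an operad by an ideal. -/
def quotientAct (n : ℕ) :
    Perm (Fin n) →* ((P.carrier n ⧸ I.carrier n) →ₗ[ℝ] (P.carrier n ⧸ I.carrier n)) where
  toFun σ := (I.carrier n).mapQ (I.carrier n) (P.act n σ) fun _ ha => I.act_mem σ ha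
  map_one' := by
    ext x
    simp
  map_mul' σ τ := by
    ext x
    simp

/-- The partial compositions on the quotient of an operad by an ideal. -/
def quotientComp {n m k : ℕ} (h : n + m = k + 1) (i : Fin n) :
    (P.carrier n ⧸ I.carrier n) →ₗ[ℝ] (P.carrier m ⧸ I.carrier m) →ₗ[ℝ]
      (P.carrier k ⧸ I.carrier k) :=
  (I.carrier n).liftQ
    { toFun := fun a => (I.carrier m).mapQ (I.carrier k) (P.comp h i a)
        fun _ hb => I.comp_mem_right h i a hb
      map_add' := fun a a' => by ext b; simp
      map_smul' := fun r a => by ext b; simp }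
    (fun a ha => by
      rw [LinearMap.mem_ker]
      ext b
      simpa using I.comp_mem_left h i b ha)

theorem quotientComp_mk {n m k : ℕ} (h : n + m = k + 1) (i : Fin n) (a : P.carrier n)
    (b : P.carrier m) :
    I.quotientComp h i (Submodule.Quotient.mk a) (Submodule.Quotient.mk b) =
      Submodule.Quotient.mk (P.comp h i a b) := rfl

theorem quotientAct_mk {n : ℕ} (σ : Perm (Fin n)) (a : P.carrier n) :
    I.quotientAct n σ (Submodule.Quotient.mk a) = Submodule.Quotient.mk (P.act n σ a) := rfl

/-- The quotient of an operad by an operadic ideal. -/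
def quotient : LinearOperad.{u} where
  carrier n := P.carrier n ⧸ I.carrier n
  act := I.quotientAct
  one := Submodule.Quotient.mk P.one
  comp := I.quotientComp
  sequential h₁ h₂ h₃ h₄ i j l hl x y z := by
    obtain ⟨a, rfl⟩ := Submodule.Quotient.mk_surjective _ x
    obtain ⟨b, rfl⟩ := Submodule.Quotient.mk_surjective _ y
    obtain ⟨c, rfl⟩ := Submodule.Quotient.mk_surjective _ z
    simp only [quotientComp_mk, P.sequential h₁ h₂ h₃ h₄ i j l hl a b c]
  parallel h₁ h₂ h₃ h₄ i j l i' hij hl hi x y z := by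
    obtain ⟨a, rfl⟩ := Submodule.Quotient.mk_surjective _ x
    obtain ⟨b, rfl⟩ := Submodule.Quotient.mk_surjective _ y
    obtain ⟨c, rfl⟩ := Submodule.Quotient.mk_surjective _ z
    simp only [quotientComp_mk, P.parallel h₁ h₂ h₃ h₄ i j l i' hij hl hi a b c]
  comp_act h i σ x y := by
    obtain ⟨a, rfl⟩ := Submodule.Quotient.mk_surjective _ x
    obtain ⟨b, rfl⟩ := Submodule.Quotient.mk_surjective _ y
    simp only [quotientComp_mk, quotientAct_mk, P.comp_act]
  act_comp h i τ x y := by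
    obtain ⟨a, rfl⟩ := Submodule.Quotient.mk_surjective _ x
    obtain ⟨b, rfl⟩ := Submodule.Quotient.mk_surjective _ y
    simp only [quotientComp_mk, quotientAct_mk, P.act_comp]
  comp_one i x := by
    obtain ⟨a, rfl⟩ := Submodule.Quotient.mk_surjective _ x
    simp only [quotientComp_mk, P.comp_one]
  one_comp x := by
    obtain ⟨a, rfl⟩ := Submodule.Quotient.mk_surjective _ x
    simp only [quotientComp_mk, P.one_comp]

end OperadIdeal

/-! ### The operad of commutative trialgebras -/

namespace ComTriass

/-- A basis of the `𝕊`-module of generators of the operad of commutative trialgebras: in arity `2`,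
the elements `σ ⋆ ν` for `σ` in `𝕊₂`, together with `μ`. -/
inductive Gen : ℕ → Type
  | nu (σ : Perm (Fin 2)) : Gen 2
  | mu : Gen 2

/-- The symmetric group acts freely on the elements `σ ⋆ ν`, and fixes `μ`. -/
def Gen.act : ∀ {n : ℕ}, Perm (Fin n) → Gen n → Gen n
  | _, σ, Gen.nu τ => Gen.nu (σ * τ)
  | _, _, Gen.mu => Gen.mu

/-- The `𝕊`-module `(0, 0, ℝ[𝕊₂]·ν ⊕ ℝ·μ, 0, …)`. -/
def generators : SModule.{0} where
  carrier n := Gen n →₀ ℝ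
  act n :=
    { toFun := fun σ => Finsupp.lmapDomain ℝ ℝ (Gen.act σ)
      map_one' := by
        have h : (Gen.act (1 : Perm (Fin n))) = id := by
          funext g
          cases g <;> simp [Gen.act]
        rw [h, Finsupp.lmapDomain_id]
        rfl
      map_mul' := fun σ τ => by
        have h : Gen.act (σ * τ) = Gen.act σ ∘ Gen.act τ := by
          funext g
          cases g <;> simp [Gen.act, mul_assoc]
        rw [h, Finsupp.lmapDomain_comp]
        rfl }

/-- The generator `ν` in the free operad. -/
def freeNu : (FreeOperad generators).carrier 2 :=
  (FreeOperad.ι generators).toFun 2 (Finsupp.single (Gen.nu 1) 1)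

/-- The generator `μ` in the free operad. -/
def freeMu : (FreeOperad generators).carrier 2 :=
  (FreeOperad.ι generators).toFun 2 (Finsupp.single Gen.mu 1)

/-- The partial compositions `a ∘₁ b` (for `i = 0`) and `a ∘₂ b` (for `i = 1`) of two binary
operations in the free operad. -/
def bin (i : Fin 2) (a b : (FreeOperad generators).carrier 2) :
    (FreeOperad generators).carrier 3 :=
  (FreeOperad generators).comp (show 2 + 2 = 3 + 1 from rfl) i a b

/-- The defining relations: `rel n x` means that `x = 0` is one of them. -/
inductive rel : ∀ n, (FreeOperad generators).carrier n → Prop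
  | assoc : rel 3 (bin 0 freeMu freeMu - bin 1 freeMu freeMu)
  | perm : rel 3 (bin 0 freeNu freeNu - bin 1 freeNu freeNu)
  | perm' : rel 3 (bin 1 freeNu freeNu -
      bin 1 freeNu ((FreeOperad generators).act 2 (Equiv.swap 0 1) freeNu))
  | mix : rel 3 (bin 1 freeNu freeMu - bin 1 freeNu freeNu)
  | mix' : rel 3 (bin 0 freeNu freeMu - bin 1 freeMu freeNu)

end ComTriass

/-- The operad `𝒞om𝒯riass = 𝕋(M)/(R)` of commutative trialgebras. -/
def ComTriass : LinearOperad.{0} :=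
  (OperadIdeal.span (FreeOperad ComTriass.generators) fun n => {x | ComTriass.rel n x}).quotient

namespace ComTriass

/-- The permutative binary generator `ν`. -/
def nu : ComTriass.carrier 2 := Submodule.Quotient.mk freeNu

/-- The commutative binary generator `μ`. -/
def mu : ComTriass.carrier 2 := Submodule.Quotient.mk freeMu

/-- For `1 ≤ k ≤ n`, the operation
`ν(⋯ν(ν(μ(⋯μ(μ(x₁, x₂), x₃)⋯, x_k), x_{k+1}), x_{k+2})⋯, x_n)` of arity `n`. -/
def leftComb (k : ℕ) : ∀ n : ℕ, ComTriass.carrier n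
  | 0 => 0
  | 1 => ComTriass.one
  | n + 2 => ComTriass.comp (show 2 + (n + 1) = (n + 2) + 1 by omega) 0
      (if n + 2 ≤ k then mu else nu) (leftComb k (n + 1))

/-- The permutation of `Fin n` which maps the first `|S|` elements increasingly onto `S`, and the
other ones increasingly onto the complement of `S`. -/
def unshuffle {n : ℕ} (S : Finset (Fin n)) : Perm (Fin n) :=
  (finCongr (by rw [Finset.card_add_card_compl, Fintype.card_fin] : n = S.card + Sᶜ.card)).trans
    (finSumFinEquiv.symm.trans (finSumEquivOfFinset rfl rfl))

/-- The operation `e_S`, for `S = {s₁ < ⋯ < s_k}` non-empty with complement `{t₁ < ⋯ < t_l}`: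
`e_S(x₁, …, x_n) = ν(⋯ν(μ(⋯μ(x_{s₁}, x_{s₂})⋯, x_{s_k}), x_{t₁})⋯, x_{t_l})`. -/
def basisElt {n : ℕ} (S : Finset (Fin n)) : ComTriass.carrier n :=
  ComTriass.act n (unshuffle S) (leftComb S.card n)

end ComTriass

/-! ### The operad of cooperative games -/

/-- The space `𝔾(n)` of (grounded) cooperative games with `n` players. -/
def Game (n : ℕ) : Submodule ℝ (Finset (Fin n) → ℝ) where
  carrier := {v | v ∅ = 0}
  zero_mem' := rfl
  add_mem' {v w} hv hw := by
    simp only [Set.mem_ofPred_eq] at hv hw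
    simp [hv, hw]
  smul_mem' r v hv := by
    simp only [Set.mem_ofPred_eq] at hv
    simp [hv]

namespace Game

/-- The derivative `∂ᵢv` of a coalition function at the player `i`. -/
def derivAt {n : ℕ} (i : Fin n) (v : Finset (Fin n) → ℝ) (S : Finset (Fin n)) : ℝ :=
  v (insert i S) - v (S.erase i)

/-- The Möbius transform of a coalition function. -/
def mobius {n : ℕ} (v : Finset (Fin n) → ℝ) (S : Finset (Fin n)) : ℝ :=
  ∑ T ∈ S.powerset, (-1 : ℝ) ^ (S \ T).card * v T

theorem mem_map_inv {n : ℕ} (σ : Perm (Fin n)) (S : Finset (Fin n)) (a : Fin n) :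
    a ∈ S.map (σ⁻¹ : Perm (Fin n)).toEmbedding ↔ σ a ∈ S := by
  rw [Finset.mem_map_equiv]
  rfl

/-- The relabelling action of the symmetric groups on games. -/
def actHom (n : ℕ) : Perm (Fin n) →* (Game n →ₗ[ℝ] Game n) where
  toFun σ :=
    { toFun := fun v => ⟨fun S => v.1 (S.map (σ⁻¹ : Perm (Fin n)).toEmbedding), by
        change v.1 _ = 0
        rw [Finset.map_empty]
        exact v.2⟩
      map_add' := fun v w => rfl
      map_smul' := fun r v => rfl }
  map_one' := by
    ext v S
    change v.1 _ = v.1 S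
    refine congrArg v.1 (Finset.ext fun a => ?_)
    rw [mem_map_inv]
    rfl
  map_mul' σ τ := by
    ext v S
    change v.1 _ = v.1 _
    refine congrArg v.1 (Finset.ext fun a => ?_)
    simp only [mem_map_inv]
    rfl

/-- The part `S_A = S ∩ A` of a coalition `S` of the composite player set `(A ∖ {i}) ∪ B`, where `A`
has `n` players, `B` has `m` players, and `B` is inserted at the position of `i`. -/
def outerPart {n m k : ℕ} (h : n + m = k + 1) (i : Fin n) (S : Finset (Fin k)) :
    Finset (Fin n) :=
  Finset.univ.filter fun a => ∃ ha : a ≠ i, insertEquiv h i (Sum.inl ⟨a, ha⟩) ∈ S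

/-- The part `S_B = S ∩ B` of a coalition `S` of the composite player set `(A ∖ {i}) ∪ B`. -/
def innerPart {n m k : ℕ} (h : n + m = k + 1) (i : Fin n) (S : Finset (Fin k)) :
    Finset (Fin m) :=
  Finset.univ.filter fun b => insertEquiv h i (Sum.inr b) ∈ S

/-- The coalition function of the partial composition of two games:
`S ↦ β(B) α(S_A) + ∂ᵢα(S_A) β(S_B)`. -/
def compFun {n m k : ℕ} (h : n + m = k + 1) (i : Fin n) (α : Finset (Fin n) → ℝ)
    (β : Finset (Fin m) → ℝ) (S : Finset (Fin k)) : ℝ :=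
  β Finset.univ * α (outerPart h i S) + derivAt i α (outerPart h i S) * β (innerPart h i S)

theorem mem_outerPart {n m k : ℕ} (h : n + m = k + 1) (i : Fin n) (S : Finset (Fin k))
    (a : Fin n) : a ∈ outerPart h i S ↔ ∃ ha : a ≠ i, insertEquiv h i (Sum.inl ⟨a, ha⟩) ∈ S := by
  simp [outerPart]

theorem mem_innerPart {n m k : ℕ} (h : n + m = k + 1) (i : Fin n) (S : Finset (Fin k))
    (b : Fin m) : b ∈ innerPart h i S ↔ insertEquiv h i (Sum.inr b) ∈ S := by
  simp [innerPart]

theorem insertEquiv_inl {n m k : ℕ} (h : n + m = k + 1) (i : Fin n) (a : {a : Fin n // a ≠ i}) :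
    (insertEquiv h i (Sum.inl a)).val =
      if a.1.val < i.val then a.1.val else a.1.val + m - 1 := rfl

theorem insertEquiv_inr {n m k : ℕ} (h : n + m = k + 1) (i : Fin n) (b : Fin m) :
    (insertEquiv h i (Sum.inr b)).val = i.val + b.val := rfl

theorem mem_of_val {k : ℕ} {S : Finset (Fin k)} {x y : Fin k} (hx : x ∈ S) (h : x.val = y.val) :
    y ∈ S := Fin.ext h ▸ hx

theorem notMem_outerPart {n m k : ℕ} (h : n + m = k + 1) (i : Fin n) (S : Finset (Fin k)) :
    i ∉ outerPart h i S := by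
  rw [mem_outerPart]
  rintro ⟨ha, -⟩
  exact ha rfl

theorem outerPart_univ {n m k : ℕ} (h : n + m = k + 1) (i : Fin n) :
    outerPart h i Finset.univ = Finset.univ.erase i := by
  ext a
  simp [mem_outerPart]

theorem innerPart_univ {n m k : ℕ} (h : n + m = k + 1) (i : Fin n) :
    innerPart h i Finset.univ = Finset.univ := by
  ext a
  simp [mem_innerPart]

theorem compFun_univ {n m k : ℕ} (h : n + m = k + 1) (i : Fin n) (α : Finset (Fin n) → ℝ)
    (β : Finset (Fin m) → ℝ) :
    compFun h i α β Finset.univ = β Finset.univ * α Finset.univ := by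
  simp only [compFun, derivAt, outerPart_univ, innerPart_univ, Finset.erase_idem,
    Finset.insert_erase (Finset.mem_univ i)]
  ring

section Parts

variable {p q r s t w : ℕ} (h₁ : p + q = s + 1) (h₂ : s + r = w + 1)

/-- Old players, inserting inside of the block. -/
theorem seq_outer (h₄ : p + t = w + 1) (h₃ : q + r = t + 1) (i : Fin p) (j : Fin q) (l : Fin s)
    (hl : l.val = i.val + j.val) (S : Finset (Fin w)) :
    outerPart h₁ i (outerPart h₂ l S) = outerPart h₄ i S := by
  ext a
  simp only [mem_outerPart]
  have := j.isLt
  constructor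
  · rintro ⟨ha, hb, hS⟩
    refine ⟨ha, mem_of_val hS ?_⟩
    have h5 : a.val ≠ i.val := fun e => ha (Fin.ext e)
    simp only [insertEquiv_inl]
    split_ifs <;> omega
  · rintro ⟨ha, hS⟩
    have h5 : a.val ≠ i.val := fun e => ha (Fin.ext e)
    refine ⟨ha, fun e => ?_, mem_of_val hS ?_⟩
    · have e' := congrArg Fin.val e
      rw [insertEquiv_inl] at e'
      simp only at e'
      split_ifs at e' <;> omega
    · simp only [insertEquiv_inl]
      split_ifs <;> omega

theorem seq_mid (h₄ : p + t = w + 1) (h₃ : q + r = t + 1) (i : Fin p) (j : Fin q) (l : Fin s)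
    (hl : l.val = i.val + j.val) (S : Finset (Fin w)) :
    innerPart h₁ i (outerPart h₂ l S) = outerPart h₃ j (innerPart h₄ i S) := by
  ext a
  simp only [mem_outerPart, mem_innerPart]
  have := j.isLt
  have e₁ := insertEquiv_inr h₁ i a
  constructor
  · rintro ⟨hb, hS⟩
    have ha : a ≠ j := fun e => hb (Fin.ext (by rw [insertEquiv_inr, e, hl]))
    have e₂ := insertEquiv_inr h₄ i (insertEquiv h₃ j (Sum.inl ⟨a, ha⟩))
    have h5 : a.val ≠ j.val := fun e => ha (Fin.ext e)
    refine ⟨ha, mem_of_val hS ?_⟩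
    rw [e₂]
    simp only [insertEquiv_inl]
    split_ifs <;> omega
  · rintro ⟨ha, hS⟩
    have e₂ := insertEquiv_inr h₄ i (insertEquiv h₃ j (Sum.inl ⟨a, ha⟩))
    have h5 : a.val ≠ j.val := fun e => ha (Fin.ext e)
    refine ⟨fun e => ?_, mem_of_val hS ?_⟩
    · have e' := congrArg Fin.val e
      omega
    · rw [e₂]
      simp only [insertEquiv_inl]
      split_ifs <;> omega

theorem seq_inner (h₄ : p + t = w + 1) (h₃ : q + r = t + 1) (i : Fin p) (j : Fin q) (l : Fin s)
    (hl : l.val = i.val + j.val) (S : Finset (Fin w)) :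
    innerPart h₂ l S = innerPart h₃ j (innerPart h₄ i S) := by
  ext a
  simp only [mem_innerPart]
  constructor <;> intro hS <;> refine mem_of_val hS ?_ <;> simp only [insertEquiv_inr] <;> omega

/-- A player of the composite which lies in the block is not one of the old players. -/
theorem outer_insert_block (i : Fin p) (j : Fin q) (l : Fin s) (hl : l.val = i.val + j.val)
    (X : Finset (Fin s)) :
    outerPart h₁ i (insert l X) = outerPart h₁ i X ∧
    outerPart h₁ i (X.erase l) = outerPart h₁ i X ∧
    innerPart h₁ i (insert l X) = insert j (innerPart h₁ i X) ∧
    innerPart h₁ i (X.erase l) = (innerPart h₁ i X).erase j := by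
  have hl' : l = insertEquiv h₁ i (Sum.inr j) := Fin.ext hl
  subst hl'
  refine ⟨?_, ?_, ?_, ?_⟩ <;> ext a <;>
    simp [mem_outerPart, mem_innerPart, Finset.mem_insert, Finset.mem_erase]

/-- A player of the composite which does not lie in the block is one of the old players. -/
theorem outer_insert_old (i : Fin p) (j : Fin p) (hj : j ≠ i) (l : Fin s)
    (hl : l = insertEquiv h₁ i (Sum.inl ⟨j, hj⟩)) (X : Finset (Fin s)) :
    outerPart h₁ i (insert l X) = insert j (outerPart h₁ i X) ∧
    outerPart h₁ i (X.erase l) = (outerPart h₁ i X).erase j ∧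
    innerPart h₁ i (insert l X) = innerPart h₁ i X ∧
    innerPart h₁ i (X.erase l) = innerPart h₁ i X := by
  subst hl
  refine ⟨?_, ?_, ?_, ?_⟩ <;> ext a <;>
    simp [mem_outerPart, mem_innerPart, Finset.mem_insert, Finset.mem_erase]
  constructor
  · rintro ⟨ha, h | h⟩
    · exact Or.inl h
    · exact Or.inr ⟨ha, h⟩
  · rintro (rfl | ⟨ha, h⟩)
    · exact ⟨hj, Or.inl rfl⟩
    · exact ⟨ha, Or.inr h⟩

theorem par_outer (h₃ : p + r = t + 1) (h₄ : t + q = w + 1) (i j : Fin p) (l : Fin s)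
    (i' : Fin t) (hij : i < j) (hl : l.val + 1 = j.val + q) (hi : i'.val = i.val)
    (S : Finset (Fin w)) :
    outerPart h₁ i (outerPart h₂ l S) = outerPart h₃ j (outerPart h₄ i' S) := by
  have hij' : i.val < j.val := hij
  ext a
  simp only [mem_outerPart]
  constructor
  · rintro ⟨ha, hb, hS⟩
    have h5 : a.val ≠ i.val := fun e => ha (Fin.ext e)
    have h6 : a.val ≠ j.val := fun e => hb (Fin.ext (by
      rw [insertEquiv_inl]; simp only; split_ifs <;> omega))
    refine ⟨fun e => h6 (congrArg Fin.val e), fun e => ?_, mem_of_val hS ?_⟩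
    · have e' := congrArg Fin.val e
      rw [insertEquiv_inl] at e'
      simp only at e'
      split_ifs at e' <;> omega
    · simp only [insertEquiv_inl]
      split_ifs <;> omega
  · rintro ⟨ha, hb, hS⟩
    have h5 : a.val ≠ j.val := fun e => ha (Fin.ext e)
    have h6 : a.val ≠ i.val := fun e => hb (Fin.ext (by
      rw [insertEquiv_inl]; simp only; split_ifs <;> omega))
    refine ⟨fun e => h6 (congrArg Fin.val e), fun e => ?_, mem_of_val hS ?_⟩
    · have e' := congrArg Fin.val e
      rw [insertEquiv_inl] at e'
      simp only at e'
      split_ifs at e' <;> omega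
    · simp only [insertEquiv_inl]
      split_ifs <;> omega

theorem par_inner₁ (h₃ : p + r = t + 1) (h₄ : t + q = w + 1) (i j : Fin p) (l : Fin s)
    (i' : Fin t) (hij : i < j) (hl : l.val + 1 = j.val + q) (hi : i'.val = i.val)
    (S : Finset (Fin w)) :
    innerPart h₁ i (outerPart h₂ l S) = innerPart h₄ i' S := by
  have hij' : i.val < j.val := hij
  ext a
  have ha := a.isLt
  have e₁ := insertEquiv_inr h₁ i a
  have e₂ := insertEquiv_inr h₄ i' a
  simp only [mem_outerPart, mem_innerPart]
  constructor
  · rintro ⟨hb, hS⟩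
    refine mem_of_val hS ?_
    simp only [insertEquiv_inl]
    split_ifs <;> omega
  · intro hS
    refine ⟨fun e => ?_, mem_of_val hS ?_⟩
    · have e' := congrArg Fin.val e
      omega
    · simp only [insertEquiv_inl]
      split_ifs <;> omega

theorem par_inner₂ (h₃ : p + r = t + 1) (h₄ : t + q = w + 1) (i j : Fin p) (l : Fin s)
    (i' : Fin t) (hij : i < j) (hl : l.val + 1 = j.val + q) (hi : i'.val = i.val)
    (S : Finset (Fin w)) :
    innerPart h₂ l S = innerPart h₃ j (outerPart h₄ i' S) := by
  have hij' : i.val < j.val := hij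
  ext a
  have ha := a.isLt
  have e₁ := insertEquiv_inr h₃ j a
  have e₂ := insertEquiv_inr h₂ l a
  simp only [mem_outerPart, mem_innerPart]
  constructor
  · intro hS
    refine ⟨fun e => ?_, mem_of_val hS ?_⟩
    · have e' := congrArg Fin.val e
      omega
    · simp only [insertEquiv_inl]
      split_ifs <;> omega
  · rintro ⟨hb, hS⟩
    refine mem_of_val hS ?_
    simp only [insertEquiv_inl]
    split_ifs <;> omega

theorem innerPerm_inl {n m k : ℕ} (h : n + m = k + 1) (i : Fin n) (σ : Perm (Fin m))
    (a : {a : Fin n // a ≠ i}) :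
    innerPerm h i σ (insertEquiv h i (Sum.inl a)) = insertEquiv h i (Sum.inl a) := by
  simp [innerPerm]

theorem innerPerm_inr {n m k : ℕ} (h : n + m = k + 1) (i : Fin n) (σ : Perm (Fin m))
    (b : Fin m) :
    innerPerm h i σ (insertEquiv h i (Sum.inr b)) = insertEquiv h i (Sum.inr (σ b)) := by
  simp [innerPerm]

theorem outerPerm_inl {n m k : ℕ} (h : n + m = k + 1) (i : Fin n) (τ : Perm (Fin n))
    (a : Fin n) (ha : a ≠ i) :
    outerPerm h i τ (insertEquiv h i (Sum.inl ⟨a, ha⟩)) =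
      insertEquiv h (τ i) (Sum.inl ⟨τ a, τ.injective.ne ha⟩) := by
  simp [outerPerm, Equiv.subtypeEquiv]

theorem outerPerm_inr {n m k : ℕ} (h : n + m = k + 1) (i : Fin n) (τ : Perm (Fin n))
    (b : Fin m) :
    outerPerm h i τ (insertEquiv h i (Sum.inr b)) = insertEquiv h (τ i) (Sum.inr b) := by
  simp [outerPerm]

end Parts

/-- The partial composition of games, as a bilinear map. -/
def compHom {n m k : ℕ} (h : n + m = k + 1) (i : Fin n) : Game n →ₗ[ℝ] Game m →ₗ[ℝ] Game k :=
  LinearMap.mk₂ ℝ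
    (fun α β => ⟨compFun h i α.1 β.1, by
      have h1 : outerPart h i (∅ : Finset (Fin k)) = ∅ := by ext; simp [mem_outerPart]
      have h2 : innerPart h i (∅ : Finset (Fin k)) = ∅ := by ext; simp [mem_innerPart]
      have h3 : α.1 ∅ = 0 := α.2
      have h4 : β.1 ∅ = 0 := β.2
      change compFun h i α.1 β.1 ∅ = 0
      simp [compFun, h1, h2, h3, h4]⟩)
    (fun α α' β => by
      ext S
      simp only [compFun, derivAt, Submodule.coe_add, Pi.add_apply]
      ring)
    (fun c α β => by
      ext S
      simp only [compFun, derivAt, Submodule.coe_smul, Pi.smul_apply, smul_eq_mul]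
      ring)
    (fun α β β' => by
      ext S
      simp only [compFun, derivAt, Submodule.coe_add, Pi.add_apply]
      ring)
    (fun c α β => by
      ext S
      simp only [compFun, derivAt, Submodule.coe_smul, Pi.smul_apply, smul_eq_mul]
      ring)

/-- The unanimity game `u_S` of a non-empty coalition `S`: a coalition has value `1` if it contains
`S`, and `0` otherwise. -/
def unanimity {n : ℕ} (S : Finset (Fin n)) (hS : S.Nonempty) : Game n :=
  ⟨fun T => if S ⊆ T then 1 else 0, by
    change (if S ⊆ ∅ then (1 : ℝ) else 0) = 0
    rw [if_neg]
    rw [Finset.subset_empty]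
    exact hS.ne_empty⟩

/-- The trivial game, the unique grounded game with one player and `v({1}) = 1`. -/
def trivialGame : Game 1 :=
  ⟨fun S => if S = Finset.univ then 1 else 0, by
    change (if ∅ = Finset.univ then (1 : ℝ) else 0) = 0
    rw [if_neg (by decide)]⟩

/-- The two-player dictator game `d₁`: a coalition has value `1` if it contains the first player,
and `0` otherwise. -/
def dictator₁ : Game 2 :=
  ⟨fun S => if (0 : Fin 2) ∈ S then 1 else 0, by
    change (if (0 : Fin 2) ∈ (∅ : Finset (Fin 2)) then (1 : ℝ) else 0) = 0
    simp⟩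

/-- The two-player bargaining game `B`: the grand coalition has value `1`, and all the other
coalitions have value `0`. -/
def bargaining : Game 2 :=
  ⟨fun S => if S = Finset.univ then 1 else 0, by
    change (if ∅ = Finset.univ then (1 : ℝ) else 0) = 0
    rw [if_neg (by decide)]⟩

theorem comp_one' {n : ℕ} (i : Fin n) (α : Game n) :
    compHom (rfl : n + 1 = n + 1) i α trivialGame = α := by
  ext S
  change compFun _ i α.1 trivialGame.1 S = α.1 S
  have h1 : outerPart (rfl : n + 1 = n + 1) i S = S.erase i := by
    ext a
    rw [mem_outerPart, Finset.mem_erase]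
    constructor
    · rintro ⟨ha, h⟩
      refine ⟨ha, mem_of_val h ?_⟩
      rw [insertEquiv_inl]; split_ifs <;> simp
    · rintro ⟨ha, h⟩
      refine ⟨ha, mem_of_val h ?_⟩
      rw [insertEquiv_inl]; split_ifs <;> simp
  have h2 : innerPart (rfl : n + 1 = n + 1) i S = Finset.univ ↔ i ∈ S := by
    rw [Finset.eq_univ_iff_forall]
    simp only [mem_innerPart]
    constructor
    · intro h
      exact mem_of_val (h 0) (by simp [insertEquiv_inr])
    · intro h b
      refine mem_of_val h ?_
      rw [insertEquiv_inr]
      omega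
  simp only [compFun, derivAt, trivialGame, h1, h2, if_true, Finset.erase_idem]
  by_cases hi : i ∈ S
  · rw [if_pos hi, Finset.insert_erase hi]
    ring
  · rw [if_neg hi, Finset.erase_eq_of_notMem hi]
    ring

theorem one_comp' {n : ℕ} (α : Game n) :
    compHom (Nat.add_comm 1 n) 0 trivialGame α = α := by
  ext S
  change compFun _ 0 trivialGame.1 α.1 S = α.1 S
  have h1 : outerPart (Nat.add_comm 1 n) 0 S = ∅ := by
    ext a
    simp [mem_outerPart, Subsingleton.elim a 0]
  have h2 : innerPart (Nat.add_comm 1 n) 0 S = S := by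
    ext a
    rw [mem_innerPart]
    constructor <;> intro h <;> refine mem_of_val h ?_ <;> simp [insertEquiv_inr]
  have h3 : (insert 0 ∅ : Finset (Fin 1)) = Finset.univ := by decide
  have h4 : ¬ (∅ : Finset (Fin 1)) = Finset.univ := by decide
  simp only [compFun, derivAt, trivialGame, h1, h2, h3, Finset.erase_empty, if_true, if_neg h4]
  ring

end Game

/-- The operad `𝔾` of cooperative games. -/
def gameOperad : LinearOperad.{0} where
  carrier n := Game n
  act := Game.actHom
  one := Game.trivialGame
  comp := Game.compHom
  sequential h₁ h₂ h₃ h₄ i j l hl α β γ := by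
    ext S
    change Game.compFun h₂ l (Game.compFun h₁ i α.1 β.1) γ.1 S =
      Game.compFun h₄ i α.1 (Game.compFun h₃ j β.1 γ.1) S
    obtain ⟨e1, e2, e3, e4⟩ :=
      Game.outer_insert_block h₁ i j l hl (Game.outerPart h₂ l S)
    rw [Game.compFun.eq_def h₄, Game.compFun_univ]
    simp only [Game.compFun, Game.derivAt, e1, e2, e3, e4,
      Game.seq_outer h₁ h₂ h₄ h₃ i j l hl S, Game.seq_mid h₁ h₂ h₄ h₃ i j l hl S,
      Game.seq_inner h₂ h₄ h₃ i j l hl S]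
    ring
  parallel h₁ h₂ h₃ h₄ i j l i' hij hl hi α β γ := by
    ext S
    change Game.compFun h₂ l (Game.compFun h₁ i α.1 β.1) γ.1 S =
      Game.compFun h₄ i' (Game.compFun h₃ j α.1 γ.1) β.1 S
    have hij' : i.val < j.val := hij
    obtain ⟨e1, e2, e3, e4⟩ :=
      Game.outer_insert_old h₁ i j (ne_of_gt hij) l (Fin.ext (by
        rw [Game.insertEquiv_inl]; simp only; split_ifs <;> omega)) (Game.outerPart h₂ l S)
    obtain ⟨f1, f2, f3, f4⟩ :=
      Game.outer_insert_old h₃ j i (ne_of_lt hij) i' (Fin.ext (by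
        rw [Game.insertEquiv_inl]; simp only; split_ifs <;> omega)) (Game.outerPart h₄ i' S)
    simp only [Game.compFun, Game.derivAt, e1, e2, e3, e4, f1, f2, f3, f4,
      Game.par_outer h₁ h₂ h₃ h₄ i j l i' hij hl hi S,
      Game.par_inner₁ h₁ h₂ h₃ h₄ i j l i' hij hl hi S,
      Game.par_inner₂ h₂ h₃ h₄ i j l i' hij hl hi S]
    have hne : i ≠ j := ne_of_lt hij
    rw [Finset.erase_insert_of_ne hne, Finset.erase_insert_of_ne hne.symm,
      Finset.insert_comm i j, Finset.erase_right_comm]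
    ring
  comp_act h i σ α β := by
    ext S
    change Game.compFun h i α.1 (fun T => β.1 (T.map (σ⁻¹ : Perm _).toEmbedding)) S =
      Game.compFun h i α.1 β.1 (S.map (innerPerm h i σ)⁻¹.toEmbedding)
    have h1 : Game.outerPart h i (S.map (innerPerm h i σ)⁻¹.toEmbedding) =
        Game.outerPart h i S := by
      ext a
      simp only [Game.mem_outerPart, Game.mem_map_inv, Game.innerPerm_inl]
    have h2 : Game.innerPart h i (S.map (innerPerm h i σ)⁻¹.toEmbedding) =
        (Game.innerPart h i S).map (σ⁻¹ : Perm _).toEmbedding := by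
      ext a
      simp only [Game.mem_innerPart, Game.mem_map_inv, Game.innerPerm_inr]
    simp only [Game.compFun, h1, h2, Finset.map_univ_equiv]
  act_comp h i τ α β := by
    ext S
    change Game.compFun h (τ i) (fun T => α.1 (T.map (τ⁻¹ : Perm _).toEmbedding)) β.1 S =
      Game.compFun h i α.1 β.1 (S.map (outerPerm h i τ)⁻¹.toEmbedding)
    have h1 : Game.outerPart h i (S.map (outerPerm h i τ)⁻¹.toEmbedding) =
        (Game.outerPart h (τ i) S).map (τ⁻¹ : Perm _).toEmbedding := by
      ext a
      simp only [Game.mem_outerPart, Game.mem_map_inv, Game.outerPerm_inl, ne_eq,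
        EmbeddingLike.apply_eq_iff_eq]
    have h2 : Game.innerPart h i (S.map (outerPerm h i τ)⁻¹.toEmbedding) =
        Game.innerPart h (τ i) S := by
      ext a
      simp only [Game.mem_innerPart, Game.mem_map_inv, Game.outerPerm_inr]
    have h3 : ∀ T : Finset _, (insert (τ i) T : Finset _).map (τ⁻¹ : Perm _).toEmbedding =
        insert i (T.map (τ⁻¹ : Perm _).toEmbedding) := by
      intro T
      ext a
      simp only [Game.mem_map_inv, Finset.mem_insert, EmbeddingLike.apply_eq_iff_eq]
    have h4 : ∀ T : Finset _, (T.erase (τ i)).map (τ⁻¹ : Perm _).toEmbedding =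
        (T.map (τ⁻¹ : Perm _).toEmbedding).erase i := by
      intro T
      ext a
      simp only [Game.mem_map_inv, Finset.mem_erase, ne_eq, EmbeddingLike.apply_eq_iff_eq]
    simp only [Game.compFun, Game.derivAt, h1, h2, h3, h4]
  comp_one := Game.comp_one'
  one_comp := Game.one_comp'

end

/-! Everything is decided by the unanimity games. On the side of games, `u_S ∘ᵢ u_T` is again a
unanimity game: that of `S` with `i` replaced by `T` if `i ∈ S`, and that of `S` alone otherwise
(`Game.comp_unanimity`). The symmetric groups permute these games, and `d₁`, `B` and the unit are
`u_{1}`, `u_{1,2}` and `u_{1}`. Every computation with composites of `d₁` and `B` is thus a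
computation with subsets. In particular the defining relations hold in `𝔾`, which gives a morphism
`F` from `𝒞om𝒯riass` (`exists_hom_gameOperad`), and `F(e_S) = u_S` (`toFun_basisElt`). By Möbius
inversion the `u_S` form a basis of `𝔾(n)`, in which the coordinates of `v` are the values of its
Möbius transform.

On the side of trialgebras it remains to see that the `e_S` span. The relations rewrite every right
nested composite `g(x, g'(y, z))` of generators as a left nested one (`IsGenerator.exists_comp_eq`),
and they give `μ(ν(x, y), z) = ν(μ(x, z), y)` (`mu_comp_nu`), which moves every `μ` inside every
`ν`. Hence the relabelled left combs span a suboperad containing the unit, `ν` and `μ`, which is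
everything (`combSpan_eq_top`). A comb with `k` inputs in its `μ` part is invariant under the
permutations preserving its first `k` inputs (`act_leftComb`), so a relabelled comb depends only on
the set of inputs placed there: it is some `e_S` (`act_leftComb_eq_basisElt`).

The `e_S` span and have linearly independent images `u_S`. They therefore form a basis, which `F`
carries to a basis, and `F` is an isomorphism. No confluence argument is needed: independence is
read off in `𝔾`. Any morphism with the prescribed values also sends `e_S` to `u_S`, whence
uniqueness. -/

noncomputable section

/-! ### Unanimity games under composition and relabelling. -/

namespace Game

/-- The composite of two coalitions: the coalition `S` of old players, in which the player `i` is
replaced by the coalition `T` of new players. -/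
def joinCoalition {n m k : ℕ} (h : n + m = k + 1) (i : Fin n) (S : Finset (Fin n))
    (T : Finset (Fin m)) : Finset (Fin k) :=
  ((Finset.univ.filter fun a : {a : Fin n // a ≠ i} => a.1 ∈ S).disjSum
    (if i ∈ S then T else ∅)).map (insertEquiv h i).toEmbedding

theorem insertEquiv_inl_mem_joinCoalition {n m k : ℕ} (h : n + m = k + 1) (i : Fin n)
    (S : Finset (Fin n)) (T : Finset (Fin m)) (a : {a : Fin n // a ≠ i}) :
    insertEquiv h i (Sum.inl a) ∈ joinCoalition h i S T ↔ a.1 ∈ S := by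
  simp [joinCoalition]

theorem insertEquiv_inr_mem_joinCoalition {n m k : ℕ} (h : n + m = k + 1) (i : Fin n)
    (S : Finset (Fin n)) (T : Finset (Fin m)) (b : Fin m) :
    insertEquiv h i (Sum.inr b) ∈ joinCoalition h i S T ↔ i ∈ S ∧ b ∈ T := by
  by_cases hi : i ∈ S <;> simp [joinCoalition, hi]

/-- Containment splits into conditions on the two parts of `U`, the form in which the composition
formula for games sees `U`. The block condition is void when `i ∉ S`, since `T` is then dropped. -/
theorem joinCoalition_subset_iff {n m k : ℕ} (h : n + m = k + 1) (i : Fin n)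
    (S : Finset (Fin n)) (T : Finset (Fin m)) (U : Finset (Fin k)) :
    joinCoalition h i S T ⊆ U ↔
      S.erase i ⊆ outerPart h i U ∧ (i ∈ S → T ⊆ innerPart h i U) := by
  rw [Finset.subset_iff, ← (insertEquiv h i).forall_congr_right, Sum.forall]
  simp only [insertEquiv_inl_mem_joinCoalition, insertEquiv_inr_mem_joinCoalition,
    Finset.subset_iff, mem_outerPart, mem_innerPart, Finset.mem_erase, Subtype.forall]
  constructor
  · rintro ⟨h1, h2⟩
    exact ⟨fun a ha => ⟨ha.1, h1 a ha.1 ha.2⟩, fun hi b hb => h2 b ⟨hi, hb⟩⟩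
  · rintro ⟨h1, h2⟩
    exact ⟨fun a ha haS => (h1 ⟨ha, haS⟩).2, fun b hb => h2 hb.1 hb.2⟩

theorem joinCoalition_nonempty {n m k : ℕ} (h : n + m = k + 1) (i : Fin n)
    {S : Finset (Fin n)} {T : Finset (Fin m)} (hS : S.Nonempty) (hT : T.Nonempty) :
    (joinCoalition h i S T).Nonempty := by
  obtain ⟨b, hb⟩ := hT
  by_cases hi : i ∈ S
  · exact ⟨insertEquiv h i (Sum.inr b), (insertEquiv_inr_mem_joinCoalition ..).2 ⟨hi, hb⟩⟩
  · obtain ⟨a, ha⟩ := hS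
    exact ⟨insertEquiv h i (Sum.inl ⟨a, fun e => hi (e ▸ ha)⟩),
      (insertEquiv_inl_mem_joinCoalition ..).2 ha⟩

theorem unanimity_apply {n : ℕ} (S : Finset (Fin n)) (hS : S.Nonempty) (T : Finset (Fin n)) :
    (unanimity S hS).1 T = if S ⊆ T then 1 else 0 := rfl

theorem unanimity_congr {n : ℕ} {S T : Finset (Fin n)} (h : S = T) (hS : S.Nonempty)
    (hT : T.Nonempty) : unanimity S hS = unanimity T hT := by
  subst h
  rfl

/-- Unanimity games are stable under partial composition. -/
theorem comp_unanimity {n m k : ℕ} (h : n + m = k + 1) (i : Fin n)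
    {S : Finset (Fin n)} {T : Finset (Fin m)} (hS : S.Nonempty) (hT : T.Nonempty) :
    gameOperad.comp h i (unanimity S hS) (unanimity T hT) =
      unanimity (joinCoalition h i S T) (joinCoalition_nonempty h i hS hT) := by
  apply Subtype.ext
  funext U
  change compFun h i (unanimity S hS).1 (unanimity T hT).1 U = _
  have hU := notMem_outerPart h i U
  -- The factor `u_T(B)` is `1`, and the outer part of `U` never contains `i`. If `i ∈ S`, only the
  -- derivative term survives; if `i ∉ S`, the derivative vanishes.
  simp only [compFun, derivAt, unanimity_apply, joinCoalition_subset_iff, Finset.subset_univ,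
    if_true, Finset.erase_eq_of_notMem hU, one_mul, ← Finset.subset_insert_iff]
  by_cases hi : i ∈ S
  · have h1 : ¬ S ⊆ outerPart h i U := fun hs => hU (hs hi)
    by_cases h2 : S ⊆ insert i (outerPart h i U) <;> by_cases h3 : T ⊆ innerPart h i U <;>
      simp [hi, h1, h2, h3]
  · simp [hi, Finset.subset_insert_iff_of_notMem hi]

theorem act_unanimity {n : ℕ} (σ : Perm (Fin n)) {S : Finset (Fin n)} (hS : S.Nonempty) :
    gameOperad.act n σ (unanimity S hS) =
      unanimity (S.map σ.toEmbedding) (hS.map) := by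
  apply Subtype.ext
  funext U
  change (unanimity S hS).1 (U.map (σ⁻¹ : Perm (Fin n)).toEmbedding) = _
  simp only [unanimity_apply]
  congr 1
  rw [Finset.map_subset_iff_subset_preimage, eq_iff_iff]
  simp only [Finset.subset_iff, mem_map_inv, Finset.mem_preimage]
  rfl

theorem dictator₁_eq : dictator₁ = unanimity {0} (Finset.singleton_nonempty _) := by
  apply Subtype.ext
  funext U
  simp [dictator₁, unanimity_apply]

theorem bargaining_eq : bargaining = unanimity Finset.univ Finset.univ_nonempty := by
  apply Subtype.ext
  funext U
  simp [bargaining, unanimity_apply, Finset.univ_subset_iff]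

theorem trivialGame_eq : trivialGame = unanimity Finset.univ Finset.univ_nonempty := by
  apply Subtype.ext
  funext U
  simp only [trivialGame, unanimity_apply, Finset.univ_subset_iff]

/-! ### Möbius inversion and the basis of unanimity games. -/

/-- Möbius inversion. -/
theorem sum_mobius {n : ℕ} (v : Finset (Fin n) → ℝ) (T : Finset (Fin n)) :
    ∑ S ∈ T.powerset, mobius v S = v T := by
  induction T using Finset.induction_on generalizing v with
  | empty => simp [mobius]
  | insert a T ha ih =>
    -- The terms `mobius v S` cancel in the sum over the subsets of `insert a T`, leaving the
    -- induction hypothesis for `R ↦ v (insert a R)`. This function need not vanish at `∅`, so the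
    -- induction runs over arbitrary functions rather than games.
    have step : ∀ S ∈ T.powerset,
        mobius v (insert a S) = mobius (fun R => v (insert a R)) S - mobius v S := by
      intro S hS
      have haS : a ∉ S := fun h => ha (Finset.mem_powerset.1 hS h)
      rw [mobius, Finset.sum_powerset_insert haS, add_comm, mobius, mobius, sub_eq_add_neg,
        ← Finset.sum_neg_distrib]
      congr 1 <;> refine Finset.sum_congr rfl fun R hR => ?_
      · rw [Finset.insert_sdiff_insert, Finset.sdiff_insert_of_notMem haS]
      · have haR : a ∉ R := fun h => haS (Finset.mem_powerset.1 hR h)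
        rw [Finset.insert_sdiff_of_notMem _ haR, Finset.card_insert_of_notMem (by simp [haS]),
          pow_succ]
        ring
    rw [Finset.sum_powerset_insert ha, Finset.sum_congr rfl step, Finset.sum_sub_distrib, ih, ih]
    ring

theorem mobius_empty {n : ℕ} (v : Game n) : mobius v.1 ∅ = 0 := by
  have : v.1 ∅ = 0 := v.2
  simp [mobius, this]

/-- Evaluation at `T` keeps the coefficients of the subsets of `T`. The condition at `∅` lets the
sum run over the whole powerset, as Möbius inversion requires. -/
theorem sum_smul_unanimity_apply {n : ℕ} (c : Finset (Fin n) → ℝ) (hc : c ∅ = 0)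
    (T : Finset (Fin n)) :
    (∑ S : {S : Finset (Fin n) // S.Nonempty}, c S.1 • unanimity S.1 S.2).1 T =
      ∑ S ∈ T.powerset, c S := by
  rw [Submodule.coe_sum, Finset.sum_apply]
  simp only [Submodule.coe_smul, Pi.smul_apply, unanimity_apply, smul_eq_mul, mul_ite, mul_one,
    mul_zero]
  rw [← Finset.sum_subtype (Finset.univ.filter Finset.Nonempty) (by simp)
    (fun S => if S ⊆ T then c S else 0), ← Finset.sum_filter]
  refine Finset.sum_subset (fun S hS => ?_) fun S hS hS' => ?_
  · simpa using (Finset.mem_filter.1 hS).2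
  · have h1 : S = ∅ := by
      by_contra h
      exact hS' (by simpa [Finset.nonempty_iff_ne_empty, h] using hS)
    rw [h1, hc]

theorem sum_mobius_smul_unanimity {n : ℕ} (v : Game n) :
    ∑ S : {S : Finset (Fin n) // S.Nonempty}, mobius v.1 S.1 • unanimity S.1 S.2 = v := by
  apply Subtype.ext
  funext T
  rw [sum_smul_unanimity_apply _ (mobius_empty v), sum_mobius]

/-- Triangularity for inclusion: if the coefficients sum to `0` over the subsets of every `T`, they
vanish one by one by strong induction on `T`. -/
theorem linearIndependent_unanimity (n : ℕ) :
    LinearIndependent ℝ fun S : {S : Finset (Fin n) // S.Nonempty} => unanimity S.1 S.2 := by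
  rw [Fintype.linearIndependent_iff]
  intro g hg
  let c : Finset (Fin n) → ℝ := fun S => if h : S.Nonempty then g ⟨S, h⟩ else 0
  have hc0 : c ∅ = 0 := by simp [c]
  have hc : ∀ S : {S : Finset (Fin n) // S.Nonempty}, c S.1 = g S := fun S => by simp [c, S.2]
  have hs : ∀ T : Finset (Fin n), ∑ S ∈ T.powerset, c S = 0 := by
    intro T
    rw [← sum_smul_unanimity_apply c hc0]
    simp only [hc, hg]
    rfl
  have h0 : ∀ T, c T = 0 := by
    intro T
    induction T using Finset.strongInduction with
    | H T ih =>
      rw [← hs T]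
      refine (Finset.sum_eq_single T (fun S hS hne => ih S ?_) (by simp)).symm
      exact (Finset.mem_powerset.1 hS).ssubset_of_ne hne
  intro S
  rw [← hc, h0]

end Game

namespace ComTriass

/-! ### The defining relations in the quotient -/

theorem mk_eq_of_rel {x y : (FreeOperad generators).carrier 3} (h : rel 3 (x - y)) :
    (Submodule.Quotient.mk x : ComTriass.carrier 3) = Submodule.Quotient.mk y := by
  refine (Submodule.Quotient.eq _).2 ?_
  change _ ∈ sInf _
  rw [Submodule.mem_sInf]
  rintro _ ⟨I, hI, rfl⟩
  exact hI 3 h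

theorem mu_comp_mu : ComTriass.comp (show 2 + 2 = 3 + 1 from rfl) 0 mu mu =
    ComTriass.comp (show 2 + 2 = 3 + 1 from rfl) 1 mu mu := mk_eq_of_rel rel.assoc

theorem nu_comp_nu : ComTriass.comp (show 2 + 2 = 3 + 1 from rfl) 0 nu nu =
    ComTriass.comp (show 2 + 2 = 3 + 1 from rfl) 1 nu nu := mk_eq_of_rel rel.perm

theorem nu_comp_act_nu : ComTriass.comp (show 2 + 2 = 3 + 1 from rfl) 1 nu nu =
    ComTriass.comp (show 2 + 2 = 3 + 1 from rfl) 1 nu (ComTriass.act 2 (swap 0 1) nu) :=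
  mk_eq_of_rel rel.perm'

theorem nu_comp_mu : ComTriass.comp (show 2 + 2 = 3 + 1 from rfl) 1 nu mu =
    ComTriass.comp (show 2 + 2 = 3 + 1 from rfl) 1 nu nu := mk_eq_of_rel rel.mix

theorem nu_comp_mu' : ComTriass.comp (show 2 + 2 = 3 + 1 from rfl) 0 nu mu =
    ComTriass.comp (show 2 + 2 = 3 + 1 from rfl) 1 mu nu := mk_eq_of_rel rel.mix'

theorem act_freeMu (σ : Perm (Fin 2)) : (FreeOperad generators).act 2 σ freeMu = freeMu := by
  refine ((FreeOperad.ι generators).map_act σ (Finsupp.single Gen.mu 1)).symm.trans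
    (congrArg _ ?_)
  exact Finsupp.mapDomain_single

theorem act_freeNu (σ : Perm (Fin 2)) : (FreeOperad generators).act 2 σ freeNu =
    (FreeOperad.ι generators).toFun 2 (Finsupp.single (Gen.nu σ) 1) := by
  refine ((FreeOperad.ι generators).map_act σ (Finsupp.single (Gen.nu 1) 1)).symm.trans
    (congrArg _ ?_)
  refine Finsupp.mapDomain_single.trans ?_
  simp [Gen.act]

theorem act_mu (σ : Perm (Fin 2)) : ComTriass.act 2 σ mu = mu :=
  congrArg Submodule.Quotient.mk (act_freeMu σ)

/-- On elements: `μ(ν(x, y), z) = μ(z, ν(x, y)) = ν(μ(z, x), y) = ν(μ(x, z), y)`. This is the rule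
that moves `μ` inside `ν`. -/
theorem mu_comp_nu : ComTriass.comp (show 2 + 2 = 3 + 1 from rfl) 0 mu nu =
    ComTriass.act 3 (swap 1 2) (ComTriass.comp (show 2 + 2 = 3 + 1 from rfl) 0 nu mu) := by
  have h1 := ComTriass.act_comp (show 2 + 2 = 3 + 1 from rfl) 1 (swap 0 1) mu nu
  have h2 := ComTriass.comp_act (show 2 + 2 = 3 + 1 from rfl) 0 (swap 0 1) nu mu
  rw [swap_apply_right, act_mu, ← nu_comp_mu'] at h1
  rw [act_mu] at h2
  rw [h1]
  conv_lhs => rw [h2, ← Module.End.mul_apply, ← map_mul]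
  congr 2
  decide

theorem innerPerm_swap : innerPerm (show 2 + 2 = 3 + 1 from rfl) 1 (swap 0 1) = swap 1 2 := by
  decide

/-- Since `ν(ν(x, y), z) = ν(x, ν(y, z))`, and the inner `ν` may be reversed there, the last two
inputs commute. -/
theorem act_nu_comp_nu :
    ComTriass.act 3 (swap 1 2) (ComTriass.comp (show 2 + 2 = 3 + 1 from rfl) 0 nu nu) =
      ComTriass.comp (show 2 + 2 = 3 + 1 from rfl) 0 nu nu := by
  rw [nu_comp_nu, ← innerPerm_swap, ← ComTriass.comp_act, ← nu_comp_act_nu]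

theorem act_mu_comp_mu :
    ComTriass.act 3 (swap 1 2) (ComTriass.comp (show 2 + 2 = 3 + 1 from rfl) 0 mu mu) =
      ComTriass.comp (show 2 + 2 = 3 + 1 from rfl) 0 mu mu := by
  rw [mu_comp_mu, ← innerPerm_swap, ← ComTriass.comp_act, act_mu]

/-- The two generating operations. -/
def IsGenerator (g : ComTriass.carrier 2) : Prop := g = mu ∨ g = nu

theorem isGenerator_ite (p : Prop) [Decidable p] : IsGenerator (if p then mu else nu) := by
  split
  · exact Or.inl rfl
  · exact Or.inr rfl

/-- The reassociation rule: each of the four right nested pairs of generators is one side of a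
defining relation, or of two in succession, ending in a left nested pair. -/
theorem IsGenerator.exists_comp_eq {g g' : ComTriass.carrier 2} (hg : IsGenerator g)
    (hg' : IsGenerator g') : ∃ f f', IsGenerator f ∧ IsGenerator f' ∧
      ComTriass.comp (show 2 + 2 = 3 + 1 from rfl) 1 g g' =
        ComTriass.comp (show 2 + 2 = 3 + 1 from rfl) 0 f f' := by
  rcases hg with rfl | rfl <;> rcases hg' with rfl | rfl
  · exact ⟨mu, mu, Or.inl rfl, Or.inl rfl, mu_comp_mu.symm⟩
  · exact ⟨nu, mu, Or.inr rfl, Or.inl rfl, nu_comp_mu'.symm⟩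
  · exact ⟨nu, nu, Or.inr rfl, Or.inr rfl, nu_comp_mu.trans nu_comp_nu.symm⟩
  · exact ⟨nu, nu, Or.inr rfl, Or.inr rfl, nu_comp_nu.symm⟩

theorem leftComb_succ_succ (k n : ℕ) : leftComb k (n + 2) =
    ComTriass.comp (show 2 + (n + 1) = (n + 2) + 1 by omega) 0
      (if n + 2 ≤ k then mu else nu) (leftComb k (n + 1)) := rfl

theorem leftComb_one (k : ℕ) : leftComb k 1 = ComTriass.one := rfl

theorem leftComb_two (k : ℕ) : leftComb k 2 = if 2 ≤ k then mu else nu :=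
  ComTriass.comp_one 0 _

/-- Once all the inputs are in the commutative part, the comb does not depend on its size. -/
theorem leftComb_of_le {k l n : ℕ} (hk : n ≤ k) (hl : n ≤ l) : leftComb k n = leftComb l n := by
  induction n with
  | zero => rfl
  | succ n ih =>
    cases n with
    | zero => rfl
    | succ n => rw [leftComb_succ_succ, leftComb_succ_succ, if_pos hk, if_pos hl,
        ih (by omega) (by omega)]

/-! ### The span of the relabelled combs -/

/-- The span of the relabelled combs. -/
def combSpan (n : ℕ) : Submodule ℝ (ComTriass.carrier n) :=
  Submodule.span ℝ {x | ∃ (σ : Perm (Fin n)) (k : ℕ), 1 ≤ k ∧ k ≤ n ∧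
    x = ComTriass.act n σ (leftComb k n)}

theorem act_mem_combSpan {n : ℕ} (σ : Perm (Fin n)) {x : ComTriass.carrier n}
    (hx : x ∈ combSpan n) : ComTriass.act n σ x ∈ combSpan n := by
  have h : combSpan n ≤ (combSpan n).comap (ComTriass.act n σ) := by
    refine Submodule.span_le.2 ?_
    rintro _ ⟨τ, k, hk, hkn, rfl⟩
    refine Submodule.subset_span ⟨σ * τ, k, hk, hkn, ?_⟩
    rw [map_mul, Module.End.mul_apply]
  exact h hx

theorem leftComb_mem_combSpan {k n : ℕ} (hk : 1 ≤ k) (hn : 1 ≤ n) :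
    leftComb k n ∈ combSpan n := by
  rcases le_total k n with hkn | hkn
  · exact Submodule.subset_span ⟨1, k, hk, hkn, by rw [map_one, Module.End.one_apply]⟩
  · exact Submodule.subset_span ⟨1, n, hn, le_rfl, by
      rw [map_one, Module.End.one_apply, leftComb_of_le hkn le_rfl]⟩

theorem one_mem_combSpan : ComTriass.one ∈ combSpan 1 :=
  leftComb_mem_combSpan (k := 1) le_rfl le_rfl

theorem mu_mem_combSpan : mu ∈ combSpan 2 := by
  have h := leftComb_mem_combSpan (k := 2) (n := 2) (by omega) (by omega)
  rwa [leftComb_two, if_pos le_rfl] at h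

theorem nu_mem_combSpan : nu ∈ combSpan 2 := by
  have h := leftComb_mem_combSpan (k := 1) (n := 2) le_rfl (by omega)
  rwa [leftComb_two, if_neg (by omega)] at h

/-- By linearity and equivariance in the inserted operation, unlabelled combs suffice. -/
theorem comp_mem_of_leftComb {p n m : ℕ} (h : p + n = m + 1) (i : Fin p)
    (g : ComTriass.carrier p)
    (hg : ∀ k, 1 ≤ k → k ≤ n → ComTriass.comp h i g (leftComb k n) ∈ combSpan m)
    {x : ComTriass.carrier n} (hx : x ∈ combSpan n) : ComTriass.comp h i g x ∈ combSpan m := by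
  have h : combSpan n ≤ (combSpan m).comap (ComTriass.comp h i g) := by
    refine Submodule.span_le.2 ?_
    rintro _ ⟨τ, k, hk, hkn, rfl⟩
    change ComTriass.comp _ i g _ ∈ combSpan m
    rw [ComTriass.comp_act]
    exact act_mem_combSpan _ (hg k hk hkn)
  exact h hx

theorem nu_comp_mem_combSpan {n m : ℕ} (h : 2 + n = m + 1) {x : ComTriass.carrier n}
    (hx : x ∈ combSpan n) : ComTriass.comp h 0 nu x ∈ combSpan m := by
  refine comp_mem_of_leftComb h 0 nu (fun k hk hkn => ?_) hx
  obtain ⟨n, rfl⟩ : ∃ n', n = n' + 1 := ⟨n - 1, by omega⟩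
  obtain rfl : m = n + 2 := by omega
  have e := leftComb_succ_succ k n
  rw [if_neg (by omega)] at e
  rw [← e]
  exact leftComb_mem_combSpan hk (by omega)

/-- A comb made of `μ` alone just gets longer. Otherwise its outermost operation is `ν`, and `μ(ν(c,
y), z) = ν(μ(c, z), y)` reduces the claim to the shorter comb `c`, up to a relabelling. -/
theorem mu_comp_leftComb_mem_combSpan {k : ℕ} (hk : 1 ≤ k) : ∀ {n m : ℕ} (h : 2 + n = m + 1),
    k ≤ n → ComTriass.comp h 0 mu (leftComb k n) ∈ combSpan m
  | 0, _, _, hkn => by omega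
  | 1, m, h, _ => by
    obtain rfl : m = 2 := by omega
    rw [leftComb_one, ComTriass.comp_one]
    exact mu_mem_combSpan
  | n + 2, m, h, hkn => by
    obtain rfl : m = n + 3 := by omega
    rcases hkn.eq_or_lt with rfl | hlt
    · have e := leftComb_succ_succ (n + 3) (n + 1)
      rw [if_pos le_rfl, leftComb_of_le (l := n + 2) (by omega) le_rfl] at e
      rw [← e]
      exact leftComb_mem_combSpan (by omega) (by omega)
    · rw [leftComb_succ_succ, if_neg (by omega),
        ← ComTriass.sequential (show 2 + 2 = 3 + 1 from rfl)
          (show 3 + (n + 1) = (n + 3) + 1 by omega) _ _ 0 0 0 rfl, mu_comp_nu]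
      have e := ComTriass.act_comp (show 3 + (n + 1) = (n + 3) + 1 by omega) 0 (swap 1 2)
        (ComTriass.comp (show 2 + 2 = 3 + 1 from rfl) 0 nu mu) (leftComb k (n + 1))
      rw [show (swap 1 2 : Perm (Fin 3)) 0 = 0 by decide] at e
      rw [e, ComTriass.sequential (show 2 + 2 = 3 + 1 from rfl)
        (show 3 + (n + 1) = (n + 3) + 1 by omega) (show 2 + (n + 1) = (n + 2) + 1 by omega)
        (show 2 + (n + 2) = (n + 3) + 1 by omega) 0 0 0 rfl]
      exact act_mem_combSpan _ (nu_comp_mem_combSpan _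
        (mu_comp_leftComb_mem_combSpan hk _ (by omega)))

theorem IsGenerator.comp_mem_combSpan {g : ComTriass.carrier 2} (hg : IsGenerator g) {n m : ℕ}
    (h : 2 + n = m + 1) {x : ComTriass.carrier n} (hx : x ∈ combSpan n) :
    ComTriass.comp h 0 g x ∈ combSpan m := by
  rcases hg with rfl | rfl
  · exact comp_mem_of_leftComb h 0 mu
      (fun k hk hkn => mu_comp_leftComb_mem_combSpan hk h hkn) hx
  · exact nu_comp_mem_combSpan h hx

/-- The operation is `g(a, comb)`. Writing the comb as `g'(c, y)`, reassociation gives `g(a, g'(c,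
y)) = f(f'(a, c), y)` with a shorter comb `c`. The generator changes from `g` to `f'`, so the
induction is over all generators at once. -/
theorem IsGenerator.comp_leftComb_comp_mem_combSpan (l : ℕ) {p : ℕ} {a : ComTriass.carrier p}
    (ha : a ∈ combSpan p) (q : ℕ) : ∀ {g : ComTriass.carrier 2}, IsGenerator g →
    ∀ {s m : ℕ} (h₁ : 2 + (q + 1) = s + 1) (h₂ : s + p = m + 1) (j : Fin s), j.val = 0 →
      ComTriass.comp h₂ j (ComTriass.comp h₁ 1 g (leftComb l (q + 1))) a ∈ combSpan m := by
  induction q with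
  | zero =>
    intro g hg s m h₁ h₂ j hj
    obtain rfl : s = 2 := by omega
    obtain rfl : j = 0 := Fin.ext hj
    rw [leftComb_one, ComTriass.comp_one]
    exact hg.comp_mem_combSpan h₂ ha
  | succ q ih =>
    intro g hg s m h₁ h₂ j hj
    obtain rfl : s = q + 3 := by omega
    obtain rfl : j = 0 := Fin.ext hj
    obtain ⟨f, f', hf, hf', e⟩ := hg.exists_comp_eq (isGenerator_ite (q + 2 ≤ l))
    obtain ⟨m, rfl⟩ : ∃ m', m = m' + 1 := ⟨m - 1, by omega⟩
    rw [leftComb_succ_succ, ← ComTriass.sequential (show 2 + 2 = 3 + 1 from rfl)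
      (show 3 + (q + 1) = (q + 3) + 1 by omega) _ _ 1 0 1 rfl, e,
      ComTriass.sequential _ _ (show 2 + (q + 1) = (q + 2) + 1 by omega)
        (show 2 + (q + 2) = (q + 3) + 1 by omega) 0 1 1 rfl,
      ComTriass.sequential (show 2 + (q + 2) = (q + 3) + 1 by omega) h₂
        (show q + 2 + p = m + 1 by omega)
        (show 2 + m = m + 1 + 1 by omega) 0 0 0 rfl]
    exact hf.comp_mem_combSpan _ (ih hf' _ _ _ rfl)

/-- This is closure under `g(a, b)`. After reduction to a comb `b`, the parallel axiom inserts `b`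
before `a`. -/
theorem IsGenerator.comp_comp_mem_combSpan {g : ComTriass.carrier 2} (hg : IsGenerator g)
    {p q s m : ℕ} {a : ComTriass.carrier p} {b : ComTriass.carrier q} (ha : a ∈ combSpan p)
    (hb : b ∈ combSpan q) (h₁ : 2 + p = s + 1) (h₂ : s + q = m + 1) (j : Fin s)
    (hj : j.val = p) :
    ComTriass.comp h₂ j (ComTriass.comp h₁ 0 g a) b ∈ combSpan m := by
  refine comp_mem_of_leftComb h₂ j _ (fun l hl hlq => ?_) hb
  obtain ⟨q, rfl⟩ : ∃ q', q = q' + 1 := ⟨q - 1, by omega⟩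
  rw [ComTriass.parallel h₁ h₂ (show 2 + (q + 1) = (q + 2) + 1 by omega)
    (show q + 2 + p = m + 1 by omega) 0 1 j 0 (by decide) (by rw [hj]; exact Nat.add_comm p 1) rfl]
  exact hg.comp_leftComb_comp_mem_combSpan l ha q _ _ _ rfl

theorem leftComb_comp_mem_combSpan (k : ℕ) (hk : 1 ≤ k) {m : ℕ} {b : ComTriass.carrier m}
    (hb : b ∈ combSpan m) (n : ℕ) : ∀ {r : ℕ} (h : n + 1 + m = r + 1) (i : Fin (n + 1)),
      ComTriass.comp h i (leftComb k (n + 1)) b ∈ combSpan r := by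
  induction n with
  | zero =>
    intro r h i
    obtain rfl : r = m := by omega
    obtain rfl : i = 0 := Fin.ext (by have := i.isLt; omega)
    rw [leftComb_one, ComTriass.one_comp]
    exact hb
  | succ n ih =>
    intro r h i
    obtain ⟨r, rfl⟩ : ∃ r', r = r' + 1 := ⟨r - 1, by have := i.isLt; omega⟩
    have hg := isGenerator_ite (n + 2 ≤ k)
    -- Either the insertion takes place inside the shorter comb, or `b` replaces the last input, the
    -- second argument of the outermost generator.
    by_cases hi : i.val < n + 1
    · rw [leftComb_succ_succ, ComTriass.sequential _ h (show n + 1 + m = r + 1 by omega)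
        (show 2 + r = r + 1 + 1 by omega) 0 ⟨i.val, hi⟩ i (Nat.zero_add _).symm]
      exact hg.comp_mem_combSpan _ (ih _ _)
    · rw [leftComb_succ_succ]
      exact hg.comp_comp_mem_combSpan (leftComb_mem_combSpan hk (by omega)) hb _ h i
        (by have := i.isLt; omega)

theorem comp_mem_combSpan {n m r : ℕ} (h : n + m = r + 1) (i : Fin n) {a : ComTriass.carrier n}
    {b : ComTriass.carrier m} (ha : a ∈ combSpan n) (hb : b ∈ combSpan m) :
    ComTriass.comp h i a b ∈ combSpan r := by
  have key : combSpan n ≤ (combSpan r).comap ((ComTriass.comp h i).flip b) := by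
    refine Submodule.span_le.2 ?_
    rintro _ ⟨τ, k, hk, hkn, rfl⟩
    change ComTriass.comp h i _ b ∈ combSpan r
    have e := ComTriass.act_comp h (τ.symm i) τ (leftComb k n) b
    rw [apply_symm_apply] at e
    rw [e]
    obtain ⟨n, rfl⟩ : ∃ n', n = n' + 1 := ⟨n - 1, by omega⟩
    exact act_mem_combSpan _ (leftComb_comp_mem_combSpan k hk hb n h _)
  exact key ha

/-! ### Generation by `ν` and `μ`, and spanning by the combs. -/

/-- The map from the generators to the operad of commutative trialgebras. -/
def ofGen (n : ℕ) : (Gen n →₀ ℝ) →ₗ[ℝ] ComTriass.carrier n :=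
  (Submodule.mkQ _).comp ((FreeOperad.ι generators).toFun n)

theorem ofGen_nu (σ : Perm (Fin 2)) :
    ofGen 2 (Finsupp.single (Gen.nu σ) 1) = ComTriass.act 2 σ nu :=
  (congrArg Submodule.Quotient.mk (act_freeNu σ)).symm

/-- The operad of commutative trialgebras is generated by `ν` and `μ`. -/
theorem generator_induction (p : ∀ n, Submodule ℝ (ComTriass.carrier n))
    (hone : ComTriass.one ∈ p 1) (hnu : nu ∈ p 2) (hmu : mu ∈ p 2)
    (hact : ∀ {n : ℕ} (σ : Perm (Fin n)) (x : ComTriass.carrier n), x ∈ p n →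
      ComTriass.act n σ x ∈ p n)
    (hcomp : ∀ {n m k : ℕ} (h : n + m = k + 1) (i : Fin n) (x : ComTriass.carrier n)
      (y : ComTriass.carrier m), x ∈ p n → y ∈ p m → ComTriass.comp h i x y ∈ p k)
    {n : ℕ} (x : ComTriass.carrier n) : x ∈ p n := by
  obtain ⟨x, rfl⟩ := Submodule.Quotient.mk_surjective _ x
  obtain ⟨a, rfl⟩ := FreeOperad.mk_surjective x
  induction a with
  | @gen m x =>
    have key : ∀ x : Gen m →₀ ℝ, ofGen m x ∈ p m := by
      intro x
      induction x using Finsupp.induction_linear with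
      | zero => rw [map_zero]; exact (p _).zero_mem
      | add f g hf hg => rw [map_add]; exact (p _).add_mem hf hg
      | single g r =>
        rw [← Finsupp.smul_single_one, map_smul]
        refine (p _).smul_mem r ?_
        cases g with
        | nu σ => rw [ofGen_nu]; exact hact σ nu hnu
        | mu => exact hmu
    exact key x
  | one => exact hone
  | zero n => exact (p n).zero_mem
  | add a b iha ihb => exact (p _).add_mem iha ihb
  | smul r a iha => exact (p _).smul_mem r iha
  | act σ a iha => exact hact σ _ iha
  | comp h i a b iha ihb => exact hcomp h i _ _ iha ihb

theorem combSpan_eq_top (n : ℕ) : combSpan n = ⊤ :=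
  Submodule.eq_top_iff'.2 <| generator_induction combSpan one_mem_combSpan nu_mem_combSpan
    mu_mem_combSpan
    (fun σ _ hx => act_mem_combSpan σ hx) (fun h i _ _ hx hy => comp_mem_combSpan h i hx hy)

end ComTriass

namespace ComTriass

/-! ### Symmetries of the combs -/

theorem innerPerm_two_castSucc {n : ℕ} (σ : Perm (Fin (n + 1))) (x : Fin (n + 1)) :
    (innerPerm (show 2 + (n + 1) = (n + 2) + 1 by omega) 0 σ x.castSucc) = (σ x).castSucc := by
  have e : ∀ y : Fin (n + 1), y.castSucc =
      insertEquiv (show 2 + (n + 1) = (n + 2) + 1 by omega) 0 (Sum.inr y) :=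
    fun y => Fin.ext (by simp [Game.insertEquiv_inr])
  rw [e, Game.innerPerm_inr, e]

theorem innerPerm_two_last {n : ℕ} (σ : Perm (Fin (n + 1))) :
    innerPerm (show 2 + (n + 1) = (n + 2) + 1 by omega) 0 σ (Fin.last (n + 1)) =
      Fin.last (n + 1) := by
  have e : Fin.last (n + 1) = insertEquiv (show 2 + (n + 1) = (n + 2) + 1 by omega) 0
      (Sum.inl ⟨1, by decide⟩) :=
    Fin.ext (by simp [Game.insertEquiv_inl])
  rw [e, Game.innerPerm_inl]

/-- A permutation which fixes the last position is a permutation of the first block. -/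
theorem exists_innerPerm_eq {n : ℕ} (σ : Perm (Fin (n + 2)))
    (hσ : σ (Fin.last (n + 1)) = Fin.last (n + 1)) :
    ∃ τ : Perm (Fin (n + 1)),
      innerPerm (show 2 + (n + 1) = (n + 2) + 1 by omega) 0 τ = σ := by
  have hne : ∀ x : Fin (n + 1), σ x.castSucc ≠ Fin.last (n + 1) := fun x hx =>
    (Fin.castSucc_lt_last x).ne (σ.injective (hx.trans hσ.symm))
  let f : Fin (n + 1) → Fin (n + 1) := fun x => (σ x.castSucc).castPred (hne x)
  have hf : ∀ x, (f x).castSucc = σ x.castSucc := fun x => Fin.castSucc_castPred _ _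
  have hinj : Function.Injective f := fun x y hxy => by
    have := congrArg Fin.castSucc hxy
    rw [hf, hf] at this
    exact Fin.castSucc_injective _ (σ.injective this)
  refine ⟨Equiv.ofBijective f (Finite.injective_iff_bijective.1 hinj), Equiv.ext fun x => ?_⟩
  induction x using Fin.lastCases with
  | last => rw [innerPerm_two_last, hσ]
  | cast x => rw [innerPerm_two_castSucc]; exact hf x

/-- In a comb of arity `n + 3`, seen as a ternary operation with a comb of arity `n + 1` in its
first input, the last two inputs are those of the ternary operation. -/
theorem swap_eq_outerPerm (n : ℕ) : swap (Fin.last (n + 1)).castSucc (Fin.last (n + 2)) =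
    outerPerm (show 3 + (n + 1) = (n + 3) + 1 by omega) 0 (swap 1 2) := by
  refine Equiv.ext fun x => ?_
  obtain ⟨y, rfl⟩ := (insertEquiv (show 3 + (n + 1) = (n + 3) + 1 by omega) 0).surjective x
  have h0 : (swap 1 2 : Perm (Fin 3)) 0 = 0 := by decide
  rcases y with ⟨a, ha⟩ | b
  · rw [Game.outerPerm_inl]
    have ha' : a = 1 ∨ a = 2 := by omega
    rcases ha' with rfl | rfl
    · have e : insertEquiv (show 3 + (n + 1) = (n + 3) + 1 by omega) 0 (Sum.inl ⟨1, ha⟩) =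
          (Fin.last (n + 1)).castSucc := Fin.ext (by simp [Game.insertEquiv_inl])
      rw [e, swap_apply_left]
      refine Fin.ext ?_
      simp [Game.insertEquiv_inl, h0]
      omega
    · have e : insertEquiv (show 3 + (n + 1) = (n + 3) + 1 by omega) 0 (Sum.inl ⟨2, ha⟩) =
          Fin.last (n + 2) := Fin.ext (by simp [Game.insertEquiv_inl]; omega)
      rw [e, swap_apply_right]
      refine Fin.ext ?_
      simp [Game.insertEquiv_inl, h0]
  · rw [Game.outerPerm_inr]
    have e := Game.insertEquiv_inr (show 3 + (n + 1) = (n + 3) + 1 by omega) 0 b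
    have hb := b.isLt
    simp only [Fin.val_zero, zero_add] at e
    rw [swap_apply_of_ne_of_ne]
    · refine Fin.ext ?_
      rw [e, Game.insertEquiv_inr, h0, Fin.val_zero, zero_add]
    · intro h
      have := congrArg Fin.val h
      simp only [Fin.val_castSucc, Fin.val_last] at this
      omega
    · intro h
      have := congrArg Fin.val h
      simp only [Fin.val_last] at this
      omega

/-- The excluded value of `k` is the one separating the last two inputs. Otherwise, from arity `3`
on, the two outermost operations coincide, and `μ ∘₁ μ` and `ν ∘₁ ν` are symmetric in their last two
inputs. In arity `2` the hypotheses leave only `μ`. -/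
theorem act_swap_leftComb {k n : ℕ} (hk : 1 ≤ k) (hkn : k ≠ n + 1) :
    ComTriass.act (n + 2) (swap (Fin.last n).castSucc (Fin.last (n + 1))) (leftComb k (n + 2)) =
      leftComb k (n + 2) := by
  cases n with
  | zero => rw [leftComb_two, if_pos (by omega), act_mu]
  | succ n =>
    have hg : ∃ g, leftComb k (n + 3) = ComTriass.comp (show 3 + (n + 1) = (n + 3) + 1 by omega) 0
        (ComTriass.comp (show 2 + 2 = 3 + 1 from rfl) 0 g g) (leftComb k (n + 1)) ∧
        ComTriass.act 3 (swap 1 2) (ComTriass.comp (show 2 + 2 = 3 + 1 from rfl) 0 g g) =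
          ComTriass.comp (show 2 + 2 = 3 + 1 from rfl) 0 g g := by
      rw [leftComb_succ_succ, leftComb_succ_succ, ← ComTriass.sequential
        (show 2 + 2 = 3 + 1 from rfl) (show 3 + (n + 1) = (n + 3) + 1 by omega) _ _ 0 0 0 rfl]
      by_cases h : n + 3 ≤ k
      · rw [if_pos h, if_pos (by omega)]
        exact ⟨mu, rfl, act_mu_comp_mu⟩
      · rw [if_neg (by omega), if_neg (by omega)]
        exact ⟨nu, rfl, act_nu_comp_nu⟩
    obtain ⟨g, e, hg⟩ := hg
    have hs : swap (Fin.last (n + 1)).castSucc (Fin.last (n + 2)) =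
        outerPerm (show 3 + (n + 1) = (n + 3) + 1 by omega) 0 (swap 1 2) :=
      swap_eq_outerPerm n
    have h := ComTriass.act_comp (show 3 + (n + 1) = (n + 3) + 1 by omega) 0 (swap 1 2)
      (ComTriass.comp (show 2 + 2 = 3 + 1 from rfl) 0 g g) (leftComb k (n + 1))
    rw [show (swap 1 2 : Perm (Fin 3)) 0 = 0 by decide, hg] at h
    rw [e, hs, ← h]

/-- The combs are invariant under the permutations which preserve their two blocks of inputs. -/
theorem act_leftComb {k : ℕ} (hk : 1 ≤ k) : ∀ {n : ℕ} (σ : Perm (Fin n)),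
    (∀ x, (σ x).val < k ↔ x.val < k) → ComTriass.act n σ (leftComb k n) = leftComb k n
  | 0, σ, _ => map_zero _
  | 1, σ, _ => by
    rw [Subsingleton.elim σ 1, map_one, Module.End.one_apply]
  | n + 2, σ, hσ => by
    -- A permutation fixing the last input acts on the inner comb, where the recursion applies.
    have fixed : ∀ σ : Perm (Fin (n + 2)), (∀ x, (σ x).val < k ↔ x.val < k) →
        σ (Fin.last (n + 1)) = Fin.last (n + 1) →
        ComTriass.act (n + 2) σ (leftComb k (n + 2)) = leftComb k (n + 2) := by
      intro σ hσ hl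
      obtain ⟨τ, hτ⟩ := exists_innerPerm_eq σ hl
      rw [← hτ] at hσ ⊢
      rw [leftComb_succ_succ, ← ComTriass.comp_act, act_leftComb hk τ]
      intro x
      have := hσ x.castSucc
      rwa [innerPerm_two_castSucc] at this
    by_cases hl : σ (Fin.last (n + 1)) = Fin.last (n + 1)
    · exact fixed σ hσ hl
    have hj := hσ (Fin.last (n + 1))
    set j := σ (Fin.last (n + 1)) with hjdef
    have hjn : j.val ≤ n := by
      have := j.isLt
      have : j.val ≠ n + 1 := fun e => hl (Fin.ext e)
      omega
    have swap_iff : ∀ a b : Fin (n + 2), (a.val < k ↔ b.val < k) →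
        ∀ x, (swap a b x).val < k ↔ x.val < k := by
      intro a b hab x
      rw [swap_apply_def]
      split_ifs with h₁ h₂
      · rw [h₁, hab]
      · rw [h₂, hab]
      · rfl
    -- The swap of `j` and the last input is conjugate, by this `ρ` fixing the last input, to the
    -- swap of the last two inputs. All three positions lie in the same block, because `σ` preserves
    -- the blocks and `j` is at most `n`.
    set ρ : Perm (Fin (n + 2)) := swap j (Fin.last n).castSucc with hρ
    have hblock : j.val < k ↔ (Fin.last n).castSucc.val < k := by
      simp only [Fin.val_last, Fin.val_castSucc] at hj ⊢
      omega
    have hρl : ρ (Fin.last (n + 1)) = Fin.last (n + 1) :=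
      swap_apply_of_ne_of_ne (Ne.symm hl) (Fin.castSucc_lt_last _).ne'
    have hρa := fixed ρ (swap_iff _ _ hblock) hρl
    have hc := act_swap_leftComb (k := k) (n := n) hk (by
      simp only [Fin.val_last] at hj
      omega)
    have hconj : swap j (Fin.last (n + 1)) =
        ρ * swap (Fin.last n).castSucc (Fin.last (n + 1)) * ρ⁻¹ := by
      rw [← swap_apply_apply, hρl, hρ, swap_apply_right]
    -- Correcting `σ` by this swap brings it back to the case where the last input is fixed.
    have hrest := fixed (swap j (Fin.last (n + 1)) * σ)
      (fun x => (swap_iff _ _ hj _).trans (hσ x))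
      (by rw [Perm.mul_apply, ← hjdef, swap_apply_left])
    have hσeq : σ = ρ * swap (Fin.last n).castSucc (Fin.last (n + 1)) * ρ⁻¹ *
        (swap j (Fin.last (n + 1)) * σ) := by
      rw [← hconj, ← mul_assoc, swap_mul_self, one_mul]
    rw [hσeq, map_mul, Module.End.mul_apply, hrest, hρ, swap_inv, ← hρ, map_mul, map_mul,
      Module.End.mul_apply, Module.End.mul_apply, hρa, hc, hρa]

theorem unshuffle_apply_mem_iff {n : ℕ} (S : Finset (Fin n)) (x : Fin n) :
    unshuffle S x ∈ S ↔ x.val < S.card := by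
  have hn : n = S.card + Sᶜ.card := by rw [Finset.card_add_card_compl, Fintype.card_fin]
  obtain ⟨y, rfl⟩ := (finSumFinEquiv.trans (finCongr hn).symm).surjective x
  rcases y with a | b
  · have e : unshuffle S ((finSumFinEquiv.trans (finCongr hn).symm) (Sum.inl a)) =
        S.orderEmbOfFin rfl a := by
      simp [unshuffle]
    rw [e]
    simp
  · have e : unshuffle S ((finSumFinEquiv.trans (finCongr hn).symm) (Sum.inr b)) =
        Sᶜ.orderEmbOfFin rfl b := by
      simp [unshuffle]
    have h := Finset.orderEmbOfFin_mem Sᶜ rfl b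
    rw [e]
    simpa using Finset.mem_compl.1 h

/-- Both `σ` and `unshuffle S` send the first `k` positions onto `S`, so they differ by a
permutation preserving the two blocks, which the comb absorbs. -/
theorem act_leftComb_eq_basisElt {k n : ℕ} (hk : 1 ≤ k) (hkn : k ≤ n) (σ : Perm (Fin n)) :
    ComTriass.act n σ (leftComb k n) =
      basisElt ((Finset.univ.filter fun x : Fin n => x.val < k).map σ.toEmbedding) := by
  set S := (Finset.univ.filter fun x : Fin n => x.val < k).map σ.toEmbedding with hS
  have hcard : S.card = k := by
    rw [hS, Finset.card_map, Fin.card_filter_val_lt, min_eq_right hkn]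
  have hmem : ∀ x, σ x ∈ S ↔ x.val < k := by simp [hS]
  have h := act_leftComb hk (σ⁻¹ * unshuffle S) (fun x => by
    rw [← hmem, ← hcard, ← unshuffle_apply_mem_iff, Perm.mul_apply, Perm.inv_def,
      apply_symm_apply])
  rw [basisElt, hcard]
  conv_lhs => rw [← h, ← Module.End.mul_apply, ← map_mul, mul_inv_cancel_left]

theorem span_basisElt (n : ℕ) : Submodule.span ℝ
    (Set.range fun S : {S : Finset (Fin n) // S.Nonempty} => basisElt S.1) = ⊤ := by
  rw [eq_top_iff, ← combSpan_eq_top]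
  refine Submodule.span_mono ?_
  rintro _ ⟨σ, k, hk, hkn, rfl⟩
  refine ⟨⟨_, ?_⟩, (act_leftComb_eq_basisElt hk hkn σ).symm⟩
  exact Finset.Nonempty.map ⟨⟨0, by omega⟩, by simpa using Nat.lt_of_succ_le hk⟩

end ComTriass

/-! ### Morphisms out of a quotient -/

/-- The kernel of a morphism of operads. -/
def LinearOperad.Hom.ker {P : LinearOperad.{u}} {Q : LinearOperad.{v}} (F : P.Hom Q) :
    OperadIdeal P where
  carrier n := LinearMap.ker (F.toFun n)
  act_mem σ a ha := by
    rw [LinearMap.mem_ker] at ha ⊢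
    rw [F.map_act, ha, map_zero]
  comp_mem_left h i a b ha := by
    rw [LinearMap.mem_ker] at ha ⊢
    rw [F.map_comp, ha, map_zero, LinearMap.zero_apply]
  comp_mem_right h i a b hb := by
    rw [LinearMap.mem_ker] at hb ⊢
    rw [F.map_comp, hb, map_zero]

theorem LinearOperad.Hom.ext {P : LinearOperad.{u}} {Q : LinearOperad.{v}} {F G : P.Hom Q}
    (h : ∀ n x, F.toFun n x = G.toFun n x) : F = G := by
  obtain ⟨⟨F, _⟩, _, _⟩ := F
  obtain ⟨⟨G, _⟩, _, _⟩ := G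
  congr
  funext n
  exact LinearMap.ext (h n)

/-- A morphism of operads which vanishes on `R` factors through the quotient by `(R)`. -/
theorem OperadIdeal.exists_lift {P : LinearOperad.{u}} {Q : LinearOperad.{v}} (F : P.Hom Q)
    (R : ∀ n, Set (P.carrier n)) (hR : ∀ n, ∀ x ∈ R n, F.toFun n x = 0) :
    ∃ G : (OperadIdeal.span P R).quotient.Hom Q, ∀ n (x : P.carrier n),
      G.toFun n (Submodule.Quotient.mk x) = F.toFun n x := by
  -- The kernel is one of the ideals whose intersection defines `(R)`.
  have hle : ∀ n, (OperadIdeal.span P R).carrier n ≤ LinearMap.ker (F.toFun n) := fun n =>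
    sInf_le ⟨F.ker, fun m x hx => hR m x hx, rfl⟩
  refine ⟨{ toFun := fun n => ((OperadIdeal.span P R).carrier n).liftQ (F.toFun n) (hle n)
            map_act := ?_
            map_one := F.map_one
            map_comp := ?_ }, fun n x => rfl⟩
  · intro n σ x
    obtain ⟨x, rfl⟩ := Submodule.Quotient.mk_surjective _ x
    exact F.map_act σ x
  · intro n m k h i x y
    obtain ⟨x, rfl⟩ := Submodule.Quotient.mk_surjective _ x
    obtain ⟨y, rfl⟩ := Submodule.Quotient.mk_surjective _ y
    exact F.map_comp h i x y

/-- A morphism of operads which is bijective in each arity is an isomorphism. -/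
def LinearOperad.Iso.ofBijective {P : LinearOperad.{u}} {Q : LinearOperad.{v}} (F : P.Hom Q)
    (hF : ∀ n, Function.Bijective (F.toFun n)) : P.Iso Q where
  hom := F
  inv :=
    { toFun := fun n => (LinearEquiv.ofBijective (F.toFun n) (hF n)).symm
      map_act := fun {n} σ y => (hF n).1 (by
        have e : ∀ y, F.toFun n ((LinearEquiv.ofBijective (F.toFun n) (hF n)).symm y) = y :=
          (LinearEquiv.ofBijective (F.toFun n) (hF n)).apply_symm_apply
        change F.toFun n ((LinearEquiv.ofBijective (F.toFun n) (hF n)).symm _) = F.toFun n _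
        rw [e, F.map_act]
        exact congrArg _ (e y).symm)
      map_one := (LinearEquiv.symm_apply_eq _).2 F.map_one.symm
      map_comp := fun {n m k} h i y z => (hF k).1 (by
        have e : ∀ n y, F.toFun n ((LinearEquiv.ofBijective (F.toFun n) (hF n)).symm y) = y :=
          fun n => (LinearEquiv.ofBijective (F.toFun n) (hF n)).apply_symm_apply
        change F.toFun k ((LinearEquiv.ofBijective (F.toFun k) (hF k)).symm _) = F.toFun k _
        rw [e, F.map_comp]
        exact congrArg₂ (fun a b => Q.comp h i a b) (e n y).symm (e m z).symm) }
  inv_hom n := (LinearEquiv.ofBijective (F.toFun n) (hF n)).symm_apply_apply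
  hom_inv n := (LinearEquiv.ofBijective (F.toFun n) (hF n)).apply_symm_apply

namespace ComTriass

/-! ### The isomorphism with the operad of games -/

/-- The game corresponding to a generator. -/
def Gen.toGame : ∀ {n : ℕ}, Gen n → Game n
  | _, Gen.nu σ => gameOperad.act 2 σ Game.dictator₁
  | _, Gen.mu => Game.bargaining

theorem act_bargaining (σ : Perm (Fin 2)) :
    gameOperad.act 2 σ Game.bargaining = Game.bargaining := by
  rw [Game.bargaining_eq, Game.act_unanimity]
  exact Game.unanimity_congr (Finset.map_univ_equiv σ) _ _

theorem Gen.toGame_act {n : ℕ} (σ : Perm (Fin n)) (g : Gen n) :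
    (Gen.act σ g).toGame = gameOperad.act n σ g.toGame := by
  cases g with
  | nu τ =>
    change gameOperad.act 2 (σ * τ) _ = _
    rw [map_mul]
    rfl
  | mu => exact (act_bargaining σ).symm

/-- The morphism from the generators to the operad of games. -/
def generatorsToGame : SModule.Hom generators gameOperad.toSModule where
  toFun n := Finsupp.linearCombination ℝ (Gen.toGame (n := n))
  map_act {n} σ x := by
    have key : ∀ x : Gen n →₀ ℝ,
        Finsupp.linearCombination ℝ Gen.toGame (Finsupp.mapDomain (Gen.act σ) x) =
          Game.actHom n σ (Finsupp.linearCombination ℝ Gen.toGame x) := by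
      intro x
      induction x using Finsupp.induction_linear with
      | zero => simp
      | add f g hf hg => rw [Finsupp.mapDomain_add, map_add, hf, hg, map_add, map_add]
      | single g r =>
        rw [Finsupp.mapDomain_single, Finsupp.linearCombination_single,
          Finsupp.linearCombination_single, Gen.toGame_act, map_smul]
        rfl
    exact key x

/-- The universal property of the free operad gives the morphism, and it descends to the quotient
once the relations hold in `𝔾`. -/
theorem exists_hom_gameOperad : ∃ F : ComTriass.Hom gameOperad,
    F.toFun 2 nu = Game.dictator₁ ∧ F.toFun 2 mu = Game.bargaining := by
  obtain ⟨F, hF, -⟩ := FreeOperad.existsUnique_lift gameOperad generatorsToGame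
  have hnu : F.toFun 2 freeNu = Game.dictator₁ := by
    refine (hF 2 _).trans ((Finsupp.linearCombination_single ..).trans ?_)
    refine (one_smul ℝ (Gen.toGame (Gen.nu 1))).trans ?_
    exact LinearMap.congr_fun (map_one (gameOperad.act 2)) Game.dictator₁
  have hmu : F.toFun 2 freeMu = Game.bargaining := by
    refine (hF 2 _).trans ((Finsupp.linearCombination_single ..).trans ?_)
    exact one_smul ℝ Game.bargaining
  have hbin : ∀ i a b, F.toFun 3 (bin i a b) =
      gameOperad.comp (show 2 + 2 = 3 + 1 from rfl) i (F.toFun 2 a) (F.toFun 2 b) :=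
    fun i a b => F.map_comp _ i a b
  obtain ⟨G, hG⟩ := OperadIdeal.exists_lift F (fun n => {x | rel n x}) (by
    -- Both sides of each relation become unanimity games with three players, so only two explicit
    -- coalitions have to be compared.
    rintro n x (_ | _ | _ | _ | _) <;>
    rw [map_sub, sub_eq_zero, hbin, hbin] <;>
    simp only [F.map_act, hnu, hmu, Game.dictator₁_eq, Game.bargaining_eq, Game.act_unanimity,
      Game.comp_unanimity] <;>
    exact Game.unanimity_congr (by decide) _ _)
  exact ⟨G, (hG 2 _).trans hnu, (hG 2 _).trans hmu⟩

/-- Stated for every morphism with the prescribed values, so that it also yields uniqueness. -/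
theorem toFun_leftComb {F : ComTriass.Hom gameOperad} (hnu : F.toFun 2 nu = Game.dictator₁)
    (hmu : F.toFun 2 mu = Game.bargaining) (k : ℕ) : ∀ (n : ℕ)
    (hS : (Finset.univ.filter fun x : Fin n => x.val < k).Nonempty),
    F.toFun n (leftComb k n) = Game.unanimity _ hS
  | 0, ⟨x, _⟩ => x.elim0
  | 1, hS => by
    have hk : 0 < k := by
      obtain ⟨x, hx⟩ := hS
      have := (Finset.mem_filter.1 hx).2
      omega
    rw [leftComb_one, F.map_one]
    refine Game.trivialGame_eq.trans (Game.unanimity_congr ?_ _ _)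
    refine (Finset.filter_true_of_mem fun x _ => ?_).symm
    omega
  | n + 2, hS => by
    have hk : 0 < k := by
      obtain ⟨x, hx⟩ := hS
      have := (Finset.mem_filter.1 hx).2
      omega
    have hS' : (Finset.univ.filter fun x : Fin (n + 1) => x.val < k).Nonempty :=
      ⟨0, by simpa using hk⟩
    rw [leftComb_succ_succ, F.map_comp, toFun_leftComb hnu hmu k (n + 1) hS']
    -- Here `T` is `{0, 1}` for `μ` and `{0}` for `ν`. Its player `1` becomes the last player `n +
    -- 1` of the composite, hence the condition on `k`.
    have hmem : ∀ T : Finset (Fin 2), 0 ∈ T → (1 ∈ T ↔ n + 1 < k) →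
        Game.joinCoalition (show 2 + (n + 1) = (n + 2) + 1 by omega) 0 T
          (Finset.univ.filter fun x : Fin (n + 1) => x.val < k) =
        Finset.univ.filter fun x : Fin (n + 2) => x.val < k := by
      intro T h0 h1
      ext x
      obtain ⟨y, rfl⟩ := (insertEquiv (show 2 + (n + 1) = (n + 2) + 1 by omega) 0).surjective x
      rcases y with ⟨a, ha⟩ | b
      · obtain rfl : a = 1 := by omega
        rw [Game.insertEquiv_inl_mem_joinCoalition, h1, Finset.mem_filter, Game.insertEquiv_inl]
        simp
      · rw [Game.insertEquiv_inr_mem_joinCoalition, Finset.mem_filter, Finset.mem_filter,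
          Game.insertEquiv_inr]
        simp [h0]
    by_cases h : n + 2 ≤ k
    · rw [if_pos h, hmu, Game.bargaining_eq, Game.comp_unanimity]
      exact Game.unanimity_congr (hmem _ (by simp) (by simp; omega)) _ _
    · rw [if_neg h, hnu, Game.dictator₁_eq, Game.comp_unanimity]
      exact Game.unanimity_congr (hmem _ (by simp) (by simp; omega)) _ _

theorem toFun_basisElt {F : ComTriass.Hom gameOperad} (hnu : F.toFun 2 nu = Game.dictator₁)
    (hmu : F.toFun 2 mu = Game.bargaining) {n : ℕ} (S : Finset (Fin n)) (hS : S.Nonempty) :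
    F.toFun n (basisElt S) = Game.unanimity S hS := by
  have hpos := hS.card_pos
  have hn : 0 < n := by
    obtain ⟨x, _⟩ := hS
    exact x.pos
  have hS' : (Finset.univ.filter fun x : Fin n => x.val < S.card).Nonempty :=
    ⟨⟨0, hn⟩, by simpa using hS⟩
  rw [basisElt, F.map_act, toFun_leftComb hnu hmu _ _ hS', Game.act_unanimity]
  refine Game.unanimity_congr (Finset.ext fun x => ?_) _ _
  obtain ⟨x, rfl⟩ := (unshuffle S).surjective x
  simp [unshuffle_apply_mem_iff]

end ComTriass

end

/-! ### The isomorphism, the basis and the Möbius transform. -/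

theorem mainTheorem2 :
    ∃ φ : LinearOperad.Iso ComTriass gameOperad,
      -- `φ` sends `ν` to `d₁` and `μ` to `B`, and is the only morphism of operads which does so
      φ.hom.toFun 2 ComTriass.nu = Game.dictator₁ ∧
      φ.hom.toFun 2 ComTriass.mu = Game.bargaining ∧
      (∀ f : LinearOperad.Hom ComTriass gameOperad,
        f.toFun 2 ComTriass.nu = Game.dictator₁ → f.toFun 2 ComTriass.mu = Game.bargaining →
          f = φ.hom) ∧
      -- the operations `e_S`, for `S` non-empty, form a basis and `φ` identifies them with the
      -- unanimity games; in this basis the inverse of `φ` is the Möbius transform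
      ∀ n : ℕ,
        (∃ b : Module.Basis {S : Finset (Fin n) // S.Nonempty} ℝ (ComTriass.carrier n),
          (∀ S, b S = ComTriass.basisElt S.1) ∧
          (∀ S, φ.hom.toFun n (b S) = Game.unanimity S.1 S.2) ∧
          ∀ v : Game n, φ.inv.toFun n v =
            ∑ S : {S : Finset (Fin n) // S.Nonempty}, Game.mobius v.1 S.1 • b S) ∧
        Module.finrank ℝ (ComTriass.carrier n) = 2 ^ n - 1 := by
  obtain ⟨F, hnu, hmu⟩ := ComTriass.exists_hom_gameOperad
  have hF : ∀ n (S : {S : Finset (Fin n) // S.Nonempty}),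
      F.toFun n (ComTriass.basisElt S.1) = Game.unanimity S.1 S.2 :=
    fun n S => ComTriass.toFun_basisElt hnu hmu S.1 S.2
  -- Independence is pulled back along `F` from the unanimity games.
  have hli : ∀ n, LinearIndependent ℝ
      fun S : {S : Finset (Fin n) // S.Nonempty} => ComTriass.basisElt S.1 := fun n =>
    LinearIndependent.of_comp (F.toFun n) (by
      have h := Game.linearIndependent_unanimity n
      simp only [← hF] at h
      exact h)
  let b : ∀ n, Module.Basis {S : Finset (Fin n) // S.Nonempty} ℝ (ComTriass.carrier n) :=
    fun n => Module.Basis.mk (hli n) (ComTriass.span_basisElt n).ge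
  have hb : ∀ n S, b n S = ComTriass.basisElt S.1 := fun n S => Module.Basis.mk_apply _ _ _
  have hbij : ∀ n, Function.Bijective (F.toFun n) := by
    refine fun n => ⟨(injective_iff_map_eq_zero _).2 fun x hx => ?_, fun v => ?_⟩
    · rw [← (b n).sum_repr x, map_sum] at hx
      simp only [map_smul, hb, hF] at hx
      have h0 := Fintype.linearIndependent_iff.1 (Game.linearIndependent_unanimity n) _ hx
      rw [← (b n).sum_repr x]
      simp [h0]
    · refine ⟨∑ S, Game.mobius v.1 S.1 • b n S, ?_⟩
      rw [map_sum]
      simp only [map_smul, hb, hF]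
      exact Game.sum_mobius_smul_unanimity v
  refine ⟨.ofBijective F hbij, hnu, hmu, fun f hfnu hfmu => ?_, fun n => ⟨⟨b n, hb n, ?_, ?_⟩, ?_⟩⟩
  -- Both morphisms send each basis element `e_S` to `u_S`.
  · refine LinearOperad.Hom.ext fun n x => LinearMap.congr_fun ((b n).ext fun S => ?_) x
    rw [hb]
    exact (ComTriass.toFun_basisElt hfnu hfmu S.1 S.2).trans (hF n S).symm
  · intro S
    rw [hb]
    exact hF n S
  · intro v
    -- It suffices to apply `F` to the proposed preimage, whose image is the Möbius expansion of
    -- `v`.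
    refine (LinearEquiv.symm_apply_eq _).2 ?_
    refine (Game.sum_mobius_smul_unanimity v).symm.trans ?_
    simp only [map_sum, map_smul, hb]
    exact Finset.sum_congr rfl fun S _ => congrArg _ (hF n S).symm
  · rw [Module.finrank_eq_card_basis (b n)]
    have h : Fintype.card {S : Finset (Fin n) // ¬ S = ∅} = 2 ^ n - 1 := by
      rw [Fintype.card_subtype_compl]
      simp
    rw [← h]
    exact Fintype.card_congr (Equiv.subtypeEquivRight fun S => Finset.nonempty_iff_ne_empty)
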